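/- **Setting.** Let $\mathcal M=(S,A,T,R,\beta,L,\Phi)$ be a finite labeled Markov decision process: a finite state set $S$, a nonempty finite set $A(s)\subseteq A$ of actions available in each state $s$, transition probabilities $T(s'\mid s,a)$, rewards $R(s,a,s')\in\mathbb R$, an initial distribution $\beta$, labels $L_i\subseteq S$ and specifications $\Phi=\{(L_i,[l_i,u_i])\}_{i=1}^{n_L}$. Put $R(s,a)=\sum_{s'}T(s'\mid s,a)R(s,a,s')$. The transition graph of $\mathcal M$ has an edge $s\to s'$ iff $T(s'\mid s,a)>0$ for some $a\in A(s)$. A stationary policy $\pi$ assigns to each $s$ a probability distribution $\pi(\cdot\mid s)$ on $A(s)$; it induces the Markov chain $\mathcal M_\pi=(S,T_\pi,\beta)$ with $T_\pi(s'\mid s)=\sum_{a\in A(s)}T(s'\mid s,a)\pi(a\mid s)$, whose transition graph has an edge $s\to s'$ iff $T_\pi(s'\mid s)>0$. A terminal strongly connected component (TSCC) of $\mathcal M$ or of $\mathcal M_\pi$ is a strongly connected component of the transition graph that has no outgoing edges and is reachable from some state $s$ with $\beta_s>0$. Let $r_1,\dots,r_m$ be the TSCCs of $\mathcal M$, $r=\bigcup_k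 r_k$ and $\bar r=S\setminus r$; assume that every TSCC of $\mathcal M$ has at least two states. The set $\Pi_{CP}$ of class-preserving policies consists of the stationary policies $\pi$ such that $\mathcal M_\pi$ has the same TSCCs as $\mathcal M$. The steady-state distribution of $\pi$ is $\mathrm{Pr}^\infty_\pi(s,a)=\lim_{n\to\infty}\frac1n\sum_{t=1}^n\Pr(S_t=s,A_t=a\mid\beta,\pi)$. The policy $\pi$ (equivalently $\mathcal M_\pi$) meets the specifications if this limit exists for all $s\in S$, $a\in A(s)$, and $l_i\le\sum_{s\in L_i}\sum_{a\in A(s)}\mathrm{Pr}^\infty_\pi(s,a)\le u_i$ for all $i$. Its expected average reward is $R^\infty_\pi(\beta)=\liminf_{n\to\infty}\frac1n\sum_{t=1}^n\mathbb E[R(S_t,A_t)]$, where $S_0\sim\beta$ and actions are chosen by $\pi$. **The program.** Let $T^{\rm rel}=\{(s,s'):s\ne s',\ \exists a\in A(s),\ T(s'\mid s,a)>0\}$ and $T^{\rm rel}_k=T^{\rm rel}\cap(r_k\times r_k)$, and fix an arbitrary state $s_k^\circ\in r_k$ for each $k$. $\mathrm{LP}_2$ has variables $x_{sa},y_{sa}$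 ($s\in S$, $a\in A(s)$), $f_{ss'}$ ($(s,s')\in T^{\rm rel}$) and $f^{\rm rev}_{ss'}$ ($(s',s)\in T^{\rm rel}$). It maximizes $\sum_{s}\sum_{a\in A(s)}x_{sa}\sum_{s'}T(s'\mid s,a)R(s,a,s')$ subject to 1. $\sum_s\sum_{a\in A(s)}x_{sa}T(s'\mid s,a)=\sum_{a\in A(s')}x_{s'a}$ for all $s'\in S$; 2. $\sum_s\sum_{a\in A(s)}y_{sa}T(s'\mid s,a)=\sum_{a\in A(s')}(x_{s'a}+y_{s'a})-\beta_{s'}$ for all $s'\in S$; 3. $\sum_{s\in\bar r}\sum_{a\in A(s)}x_{sa}=0$; $x_{sa}\in[0,1]$ and $y_{sa}\ge0$ for all $s\in S$, $a\in A(s)$; 4. $l_i\le\sum_{s\in L_i}\sum_{a\in A(s)}x_{sa}\le u_i$ for all $i$; 5. for every $k$: $f_{s_k^\circ s'}=\sum_{a\in A(s_k^\circ)}T(s'\mid s_k^\circ,a)x_{s_k^\circ a}$ for $(s_k^\circ,s')\in T^{\rm rel}_k$, and $f^{\rm rev}_{s_k^\circ s'}=\sum_{a\in A(s')}T(s_k^\circ\mid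 s',a)x_{s'a}$ for $(s',s_k^\circ)\in T^{\rm rel}_k$; 6. for every $k$: $f_{ss'}\le\sum_{a\in A(s)}T(s'\mid s,a)x_{sa}$ for $(s,s')\in T^{\rm rel}_k$, and $f^{\rm rev}_{ss'}\le\sum_{a\in A(s')}T(s\mid s',a)x_{s'a}$ for $(s',s)\in T^{\rm rel}_k$; 7. for every $k$ and $s\in r_k\setminus\{s_k^\circ\}$: $\sum_{s':(s',s)\in T^{\rm rel}}f_{s's}>\sum_{s':(s,s')\in T^{\rm rel}}f_{ss'}$ and $\sum_{s':(s,s')\in T^{\rm rel}}f^{\rm rev}_{s's}>\sum_{s':(s',s)\in T^{\rm rel}}f^{\rm rev}_{ss'}$; 8. for every $s\in r$: $\sum_{s':(s',s)\in T^{\rm rel}}f_{s's}>0$ and $\sum_{s':(s,s')\in T^{\rm rel}}f^{\rm rev}_{s's}>0$; 9. $f_{ss'}\in[0,1]$ and $f^{\rm rev}_{s's}\in[0,1]$ for all $(s,s')\in T^{\rm rel}$. For $(x,y)$ put $x_s=\sum_{a\in A(s)}x_{sa}$ and $y_s=\sum_{a\in A(s)}y_{sa}$. The derived policy $\pi(x,y)$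 is $\pi(a\mid s)=x_{sa}/x_s$ if $x_s>0$, $\pi(a\mid s)=y_{sa}/y_s$ if $x_s\le0<y_s$, and an arbitrary probability distribution on $A(s)$ for the remaining $s$. **Theorem.** For every choice of the states $s_k^\circ$: $\mathrm{LP}_2$ is feasible if and only if there is a policy $\pi\in\Pi_{CP}$ that meets the specifications. Further, if $(x^*,y^*,f^*,f^{{\rm rev}*})$ is an optimal solution of $\mathrm{LP}_2$, then every derived policy $\pi^*=\pi(x^*,y^*)$ belongs to $\Pi_{CP}$, meets the specifications, and satisfies $R^\infty_{\pi}(\beta)\le R^\infty_{\pi^*}(\beta)$ for every $\pi\in\Pi_{CP}$ that meets the specifications. -/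

import Mathlib

open Filter Topology

namespace SteadyState

/-- A finite-state Markov decision process `(S, A, T, R, β)`. `act s` is the set `A(s)` of actions
available in `s`, `T s a s'` is `T(s' | s, a)` and `R s a s'` is `R(s, a, s')`. -/
structure MDP (S A : Type*) [Fintype S] where
  act : S → Finset A
  act_nonempty : ∀ s, (act s).Nonempty
  T : S → A → S → ℝ
  T_nonneg : ∀ s, ∀ a ∈ act s, ∀ s', 0 ≤ T s a s'
  T_sum : ∀ s, ∀ a ∈ act s, ∑ s', T s a s' = 1
  R : S → A → S → ℝ
  β : S → ℝ
  β_nonneg : ∀ s, 0 ≤ β s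
  β_sum : ∑ s, β s = 1

/-- A labeled MDP: an MDP with labels `L_i ⊆ S` and steady-state specifications
`(L_i, [lo i, hi i])`. -/
structure LMDP (S A : Type*) [Fintype S] extends MDP S A where
  numLabels : ℕ
  label : Fin numLabels → Finset S
  lo : Fin numLabels → ℝ
  hi : Fin numLabels → ℝ

section Digraph

variable {S : Type*}

/-- A strongly connected component of the digraph with edge relation `E`: a maximal nonempty set of
vertices, any two of which are joined by a directed path (possibly of length zero). -/
def IsSCC (E : S → S → Prop) (C : Set S) : Prop :=
  Maximal (fun D : Set S =>
    D.Nonempty ∧ ∀ s ∈ D, ∀ s' ∈ D, Relation.ReflTransGen E s s') C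

/-- A terminal strongly connected component: an SCC reachable from some state of positive initial
probability, and without edges that leave it. -/
def IsTSCC (E : S → S → Prop) (β : S → ℝ) (C : Set S) : Prop :=
  IsSCC E C ∧
  (∃ s₀, 0 < β s₀ ∧ ∃ s ∈ C, Relation.ReflTransGen E s₀ s) ∧
  ∀ s ∈ C, ∀ s', E s s' → s' ∈ C

/-- The union of all terminal strongly connected components. -/
def tsccUnion (E : S → S → Prop) (β : S → ℝ) : Set S :=
  {s | ∃ C, IsTSCC E β C ∧ s ∈ C}

end Digraph

noncomputable section

namespace MDP

variable {S A : Type*} [Fintype S]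

/-- The edges of the transition graph of the MDP. -/
def Edge (M : MDP S A) (s s' : S) : Prop := ∃ a ∈ M.act s, 0 < M.T s a s'

/-- The expected one-step reward `R(s, a) = ∑ s', T(s' | s, a) R(s, a, s')`. -/
def reward (M : MDP S A) (s : S) (a : A) : ℝ := ∑ s', M.T s a s' * M.R s a s'

/-- Stationary policies: `π s a` is `π(a | s)`, a probability distribution over `A(s)`. -/
def IsStationaryPolicy (M : MDP S A) (π : S → A → ℝ) : Prop :=
  ∀ s, (∀ a, 0 ≤ π s a) ∧ (∀ a, a ∉ M.act s → π s a = 0) ∧ ∑ a ∈ M.act s, π s a = 1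

/-- The transition function `T_π(s' | s)` of the induced Markov chain `M_π = (S, T_π, β)`. -/
def inducedT (M : MDP S A) (π : S → A → ℝ) (s s' : S) : ℝ :=
  ∑ a ∈ M.act s, M.T s a s' * π s a

/-- The edges of the transition graph of the induced Markov chain `M_π`. -/
def inducedEdge (M : MDP S A) (π : S → A → ℝ) (s s' : S) : Prop := 0 < M.inducedT π s s'

/-- `C` is a TSCC of the MDP. -/
def TSCC (M : MDP S A) (C : Set S) : Prop := IsTSCC M.Edge M.β C

/-- `C` is a TSCC of the induced Markov chain `M_π`. -/
def inducedTSCC (M : MDP S A) (π : S → A → ℝ) (C : Set S) : Prop :=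
  IsTSCC (M.inducedEdge π) M.β C

/-- The class-preserving policies: the stationary policies whose induced Markov chain has the same
TSCCs as the MDP. -/
def classPreserving (M : MDP S A) : Set (S → A → ℝ) :=
  {π | M.IsStationaryPolicy π ∧
    tsccUnion (M.inducedEdge π) M.β = tsccUnion M.Edge M.β ∧
    ∀ C, M.inducedTSCC π C ↔ M.TSCC C}

/-- The law of the state at time `t` under the policy `π`: `Pr(S_t = s | β, π)`. -/
def stateProb (M : MDP S A) (π : S → A → ℝ) : ℕ → S → ℝ
  | 0, s => M.β s
  | t + 1, s => ∑ s', stateProb M π t s' * M.inducedT π s' s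

/-- The law of the state-action pair at time `t`: `Pr(S_t = s, A_t = a | β, π)`. -/
def stateActionProb (M : MDP S A) (π : S → A → ℝ) (t : ℕ) (s : S) (a : A) : ℝ :=
  M.stateProb π t s * π s a

/-- `p` is the steady-state distribution of `π`, the long-run average of the laws of the
state-action pairs. -/
def IsSteadyState (M : MDP S A) (π p : S → A → ℝ) : Prop :=
  ∀ s, ∀ a ∈ M.act s,
    Tendsto (fun n : ℕ => (1 / (n : ℝ)) * ∑ t ∈ Finset.Icc 1 n, M.stateActionProb π t s a)
      atTop (𝓝 (p s a))

/-- The expected average reward of `π`: the lower limit of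
`(1 / n) * ∑ t = 1, …, n, E[R(S_t, A_t)]`. -/
def avgReward (M : MDP S A) (π : S → A → ℝ) : ℝ :=
  liminf (fun n : ℕ => (1 / (n : ℝ)) * ∑ t ∈ Finset.Icc 1 n,
    ∑ s, ∑ a ∈ M.act s, M.stateActionProb π t s a * M.reward s a) atTop

/-- The transition relation `T^rel`: the edges between distinct states. -/
def TRel (M : MDP S A) (s s' : S) : Prop := s ≠ s' ∧ ∃ a ∈ M.act s, 0 < M.T s a s'

/-- The restriction of `T^rel` to a set `C` of states. -/
def TRelOn (M : MDP S A) (C : Set S) (s s' : S) : Prop := M.TRel s s' ∧ s ∈ C ∧ s' ∈ C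

/-- The set `Q₀` of pairs `(x, y)`; only the entries `x s a`, `y s a` with `a ∈ A(s)` matter. -/
structure Q0 (M : MDP S A) (x y : S → A → ℝ) : Prop where
  stationary : ∀ s', ∑ s, ∑ a ∈ M.act s, x s a * M.T s a s' = ∑ a ∈ M.act s', x s' a
  visits : ∀ s', ∑ s, ∑ a ∈ M.act s, y s a * M.T s a s' =
    ∑ a ∈ M.act s', (x s' a + y s' a) - M.β s'
  transient : ∑ s ∈ (tsccUnion M.Edge M.β)ᶜ.toFinite.toFinset, ∑ a ∈ M.act s, x s a = 0
  x_mem : ∀ s, ∀ a ∈ M.act s, x s a ∈ Set.Icc (0 : ℝ) 1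
  y_nonneg : ∀ s, ∀ a ∈ M.act s, 0 ≤ y s a

open scoped Classical in
/-- The policy derived from `(x, y)`, where `π₀` supplies the arbitrary values. -/
def derivedPolicy (M : MDP S A) (x y π₀ : S → A → ℝ) (s : S) (a : A) : ℝ :=
  if a ∈ M.act s then
    if 0 < ∑ b ∈ M.act s, x s b then x s a / ∑ b ∈ M.act s, x s b
    else if 0 < ∑ b ∈ M.act s, y s b then y s a / ∑ b ∈ M.act s, y s b
    else π₀ s a
  else 0

/-- The objective of the linear program. -/
def objective (M : MDP S A) (x : S → A → ℝ) : ℝ :=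
  ∑ s, ∑ a ∈ M.act s, x s a * ∑ s', M.T s a s' * M.R s a s'

end MDP

namespace LMDP

variable {S A : Type*} [Fintype S]

/-- The induced Markov chain `M_π` satisfies all steady-state specifications. -/
def MeetsSpecs (M : LMDP S A) (π : S → A → ℝ) : Prop :=
  ∃ p, M.IsSteadyState π p ∧
    ∀ i, M.lo i ≤ ∑ s ∈ M.label i, ∑ a ∈ M.act s, p s a ∧
      ∑ s ∈ M.label i, ∑ a ∈ M.act s, p s a ≤ M.hi i

open scoped Classical in
/-- Feasibility of `(x, y, f, frev)` for the program `LP₂`. The TSCCs are the sets `C` with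
`M.TSCC C`, and `root C` is the source state chosen in `C`. The reverse flow `frev s s'` goes from
`s` to `s'` along the reversal of an edge `(s', s)` of `T^rel`. -/
structure LP2Feasible (M : LMDP S A) (root : Set S → S)
    (x y : S → A → ℝ) (f frev : S → S → ℝ) : Prop where
  q0 : M.Q0 x y
  specs : ∀ i, M.lo i ≤ ∑ s ∈ M.label i, ∑ a ∈ M.act s, x s a ∧
    ∑ s ∈ M.label i, ∑ a ∈ M.act s, x s a ≤ M.hi i
  flowInit : ∀ C, M.TSCC C → ∀ s', M.TRelOn C (root C) s' →
    f (root C) s' = ∑ a ∈ M.act (root C), M.T (root C) a s' * x (root C) a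
  flowRevInit : ∀ C, M.TSCC C → ∀ s', M.TRelOn C s' (root C) →
    frev (root C) s' = ∑ a ∈ M.act s', M.T s' a (root C) * x s' a
  flowCap : ∀ C, M.TSCC C → ∀ s s', M.TRelOn C s s' →
    f s s' ≤ ∑ a ∈ M.act s, M.T s a s' * x s a
  flowRevCap : ∀ C, M.TSCC C → ∀ s s', M.TRelOn C s' s →
    frev s s' ≤ ∑ a ∈ M.act s', M.T s' a s * x s' a
  flowTransfer : ∀ C, M.TSCC C → ∀ s ∈ C, s ≠ root C →
    ∑ s' with M.TRel s s', f s s' < ∑ s' with M.TRel s' s, f s' s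
  flowRevTransfer : ∀ C, M.TSCC C → ∀ s ∈ C, s ≠ root C →
    ∑ s' with M.TRel s' s, frev s s' < ∑ s' with M.TRel s s', frev s' s
  flowIn : ∀ C, M.TSCC C → ∀ s ∈ C, 0 < ∑ s' with M.TRel s' s, f s' s
  flowRevIn : ∀ C, M.TSCC C → ∀ s ∈ C, 0 < ∑ s' with M.TRel s s', frev s' s
  flow_mem : ∀ s s', M.TRel s s' → f s s' ∈ Set.Icc (0 : ℝ) 1
  flowRev_mem : ∀ s s', M.TRel s' s → frev s s' ∈ Set.Icc (0 : ℝ) 1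

/-- `(x, y, f, frev)` is an optimal solution of `LP₂`. -/
def LP2Optimal (M : LMDP S A) (root : Set S → S)
    (x y : S → A → ℝ) (f frev : S → S → ℝ) : Prop :=
  M.LP2Feasible root x y f frev ∧
    ∀ x' y' f' frev', M.LP2Feasible root x' y' f' frev' → M.objective x' ≤ M.objective x

end LMDP

end

end SteadyState

/-! A feasible point couples a stationary vector `x` with a vector `y` of expected visits that
carries `β` to `x`. Let `P` be the chain of the derived policy and `Q` the chain of the policy read
off from `y` alone; they agree off the terminal components, where `x` vanishes. The reverse flow
forces `x > 0` on each component (`mass_pos`) and, by a cut argument, a `P`-path from each of its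
states to the root (`reach_root`). Stationarity of `x` lets paths be reversed, so the components
stay strongly connected. Mass balances of `y` show that `P` reaches every component and has no other
terminal ones (`exists_reachable`, `exists_class_inter`). A `P`-harmonic function is constant on
each component, so the visit equation makes `β - x` orthogonal to it; the Fredholm alternative gives
`β - x = w - w P`, and the averaged laws telescope to `x` (`FlowPair.tendsto_average`).

Conversely, let `p` be the steady state of a class-preserving policy. `β` minus the `n`-th averaged
law is the image of a nonnegative vector under `1 - P`. Such images form a finitely generated, hence
closed, cone (`isClosed_image_orthant`), so `β - p` has a visit vector too (`exists_visits`). Both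
flows come from the stationary flow of `p`, damped geometrically with the distance from the roots
(`exists_flow_weight`).

The average reward is the objective at the steady state (`avgReward_eq`), so these two passages turn
optimality in the program into optimality among policies. -/

namespace SteadyState

/-! ### Reachability and terminal components of a digraph -/

section Digraph

variable {S : Type*} {E : S → S → Prop} {β : S → ℝ} {C D : Set S}

theorem mem_of_reflTransGen (hC : ∀ s ∈ C, ∀ s', E s s' → s' ∈ C) {s t : S}
    (h : Relation.ReflTransGen E s t) (hs : s ∈ C) : t ∈ C := by
  induction h with
  | refl => exact hs
  | tail _ h ih => exact hC _ ih _ h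

/-- The vertices reachable from a vertex of positive weight. -/
def reachable (E : S → S → Prop) (β : S → ℝ) : Set S :=
  {s | ∃ s₀, 0 < β s₀ ∧ Relation.ReflTransGen E s₀ s}

theorem reachable_closed : ∀ s ∈ reachable E β, ∀ s', E s s' → s' ∈ reachable E β := by
  rintro s ⟨s₀, h₀, h⟩ s' h'
  exact ⟨s₀, h₀, h.tail h'⟩

/-- To show that a property holds at every reachable vertex, it suffices to check the vertices of
positive weight and the edges between reachable vertices. -/
theorem reachable_induction {p : S → Prop} (h₀ : ∀ s, 0 < β s → p s)
    (h : ∀ s ∈ reachable E β, p s → ∀ s', E s s' → p s') : ∀ s ∈ reachable E β, p s := by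
  rintro s ⟨s₀, hs₀, hr⟩
  induction hr with
  | refl => exact h₀ _ hs₀
  | tail hr he ih => exact h _ ⟨s₀, hs₀, hr⟩ ih _ he

/-- Maximality is automatic for closed sets: a strongly connected superset is reached from inside
`C`, hence never leaves it. -/
theorem isTSCC_iff : IsTSCC E β C ↔
    (∀ s ∈ C, ∀ s' ∈ C, Relation.ReflTransGen E s s') ∧ (∀ s ∈ C, ∀ s', E s s' → s' ∈ C) ∧
      ∃ s ∈ C, s ∈ reachable E β := by
  constructor
  · rintro ⟨h1, ⟨s₀, h0, s, hs, h⟩, h3⟩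
    exact ⟨h1.prop.2, h3, s, hs, s₀, h0, h⟩
  · rintro ⟨h1, h2, s, hs, s₀, h0, h⟩
    refine ⟨⟨⟨⟨s, hs⟩, h1⟩, ?_⟩, ⟨s₀, h0, s, hs, h⟩, h2⟩
    rintro D ⟨-, hD⟩ hCD t ht
    exact mem_of_reflTransGen h2 (hD s (hCD hs) t ht) hs

theorem IsTSCC.eq_of_mem (hC : IsTSCC E β C) (hD : IsTSCC E β D) {s : S} (hsC : s ∈ C)
    (hsD : s ∈ D) : C = D := by
  rw [isTSCC_iff] at hC hD
  ext t
  exact ⟨fun ht => mem_of_reflTransGen hD.2.1 (hC.1 s hsC t ht) hsD,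
    fun ht => mem_of_reflTransGen hC.2.1 (hD.1 s hsD t ht) hsC⟩

/-- Strips loops at `s` off the end of the path. Since `T^rel` has no loops, the in-flow constraints
need an in-neighbour other than `s`. -/
theorem exists_ne_edge {s t : S} (h : Relation.ReflTransGen E t s)
    (hne : t ≠ s) : ∃ s', s' ≠ s ∧ E s' s := by
  induction h with
  | refl => exact absurd rfl hne
  | @tail u s _ he ih =>
    by_cases hus : u = s
    · subst hus; exact ih hne
    · exact ⟨u, hus, he⟩

/-- A distance-like weight: it is `1` on `Z`, and each other vertex reachable from `Z` has an
in-neighbour whose weight is larger by the factor `1 / ε`. -/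
theorem exists_decay_weight (E : S → S → Prop) (Z : Set S) {ε : ℝ} (h0 : 0 < ε) (h1 : ε < 1) :
    ∃ g : S → ℝ, (∀ s, 0 < g s ∧ g s ≤ 1) ∧ (∀ s ∈ Z, g s = 1) ∧
      ∀ s, s ∉ Z → (∃ z ∈ Z, Relation.ReflTransGen E z s) → ∃ s', E s' s ∧ g s = ε * g s' := by
  classical
  -- `N n` holds the endpoints of walks of length exactly `n` from `Z`, and `d` is the distance.
  -- Unreachable vertices get `d = 0`, as `sInf ∅ = 0`, which still keeps `g` positive.
  let N : ℕ → Set S := fun n => Nat.rec Z (fun _ K => {s | ∃ s' ∈ K, E s' s}) n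
  let d : S → ℕ := fun s => sInf {n | s ∈ N n}
  refine ⟨fun s => ε ^ d s, fun s => ⟨by positivity, pow_le_one₀ h0.le h1.le⟩, ?_, ?_⟩
  · intro s hs
    have : d s = 0 := Nat.sInf_eq_zero.2 (Or.inl hs)
    simp [this]
  · rintro s hs ⟨z, hz, hzs⟩
    have hex : ∃ n, s ∈ N n := by
      clear hs
      induction hzs with
      | refl => exact ⟨0, hz⟩
      | tail _ he ih =>
        obtain ⟨n, hn⟩ := ih
        exact ⟨n + 1, _, hn, he⟩
    have hmem : s ∈ N (d s) := Nat.sInf_mem (s := {n | s ∈ N n}) hex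
    rcases hd : d s with _ | n
    · rw [hd] at hmem; exact absurd hmem hs
    · rw [hd] at hmem
      obtain ⟨s', hs', he⟩ := hmem
      refine ⟨s', he, ?_⟩
      have hle : d s' ≤ n := Nat.sInf_le hs'
      have hge : n + 1 ≤ d s' + 1 := by
        rw [← hd]
        exact Nat.sInf_le (s := {n | s ∈ N n})
          ⟨s', Nat.sInf_mem (s := {n | s' ∈ N n}) ⟨n, hs'⟩, he⟩
      have : d s' = n := by omega
      simp only [hd, this, pow_succ']

end Digraph

/-! ### Transition kernels: mass balance, stationary vectors, harmonic functions -/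

section Kernel

open scoped Classical

variable {S : Type*} [Fintype S] {P : S → S → ℝ}

/-- The image `v P` of a row vector `v` under a transition kernel `P`. -/
noncomputable def push (P : S → S → ℝ) (v : S → ℝ) (s' : S) : ℝ := ∑ s, v s * P s s'

/-- The function `P` is a transition kernel. -/
structure IsKernel (P : S → S → ℝ) : Prop where
  nonneg : ∀ s s', 0 ≤ P s s'
  sum_eq : ∀ s, ∑ s', P s s' = 1

theorem push_sub (v w : S → ℝ) : push P (v - w) = push P v - push P w := by
  ext s; simp [push, sub_mul]

theorem sum_push_mul (v h : S → ℝ) :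
    ∑ s', push P v s' * h s' = ∑ s, v s * ∑ s', P s s' * h s' := by
  simp only [push, Finset.sum_mul, Finset.mul_sum]
  rw [Finset.sum_comm]
  simp only [mul_assoc]

theorem IsKernel.sum_closed (hP : IsKernel P) {U : Set S}
    (hU : ∀ s ∈ U, ∀ s', 0 < P s s' → s' ∈ U) {s : S} (hs : s ∈ U) :
    ∑ u with u ∈ U, P s u = 1 := by
  rw [← hP.sum_eq s]
  refine Finset.sum_subset (Finset.filter_subset _ _) fun u _ hu => ?_
  by_contra h
  exact hu (by simpa using hU s hs u (lt_of_le_of_ne (hP.nonneg s u) (Ne.symm h)))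

/-- The mass balance of a closed set. -/
theorem IsKernel.sum_push_closed (hP : IsKernel P) {U : Set S}
    (hU : ∀ s ∈ U, ∀ s', 0 < P s s' → s' ∈ U) (v : S → ℝ) :
    ∑ s' with s' ∈ U, push P v s' =
      ∑ s with s ∈ U, v s + ∑ s with s ∉ U, v s * ∑ u with u ∈ U, P s u := by
  simp only [push]
  rw [Finset.sum_comm, ← Finset.sum_filter_add_sum_filter_not _ (fun s => s ∈ U)]
  congr 1
  · refine Finset.sum_congr rfl fun s hs => ?_
    rw [← Finset.mul_sum, hP.sum_closed hU (by simpa using hs), mul_one]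
  · exact Finset.sum_congr rfl fun s _ => by rw [← Finset.mul_sum]

theorem IsKernel.sum_push (hP : IsKernel P) (v : S → ℝ) : ∑ s, push P v s = ∑ s, v s := by
  simpa using hP.sum_push_closed (U := Set.univ) (by simp) v

theorem IsKernel.push_nonneg (hP : IsKernel P) {v : S → ℝ} (hv : ∀ s, 0 ≤ v s) (s : S) :
    0 ≤ push P v s :=
  Finset.sum_nonneg fun t _ => mul_nonneg (hv t) (hP.nonneg t s)

theorem IsKernel.mul_le_push (hP : IsKernel P) {v : S → ℝ} (hv : ∀ s, 0 ≤ v s) (s s' : S) :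
    v s * P s s' ≤ push P v s' :=
  Finset.single_le_sum (f := fun s => v s * P s s')
    (fun t _ => mul_nonneg (hv t) (hP.nonneg t s')) (Finset.mem_univ s)

theorem IsKernel.push_pos (hP : IsKernel P) {v : S → ℝ} (hv : ∀ s, 0 ≤ v s) {s s' : S}
    (hs : 0 < v s) (h : 0 < P s s') : 0 < push P v s' :=
  (mul_pos hs h).trans_le (hP.mul_le_push hv s s')

/-- A vector that does not lose mass on a closed set does not flow into that set. -/
theorem IsKernel.no_inflow (hP : IsKernel P) {U : Set S}
    (hU : ∀ s ∈ U, ∀ s', 0 < P s s' → s' ∈ U) {v : S → ℝ} (hv : ∀ s, 0 ≤ v s)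
    (h : ∑ s with s ∈ U, push P v s ≤ ∑ s with s ∈ U, v s) :
    ∀ s ∉ U, ∀ s' ∈ U, 0 < v s → ¬ 0 < P s s' := by
  intro s hs s' hs' hvs hpos
  -- A closed set keeps its own mass, so its net gain is the inflow, a sum of nonnegative terms that
  -- must therefore all vanish.
  have hb := hP.sum_push_closed hU v
  have h1 : v s * ∑ u with u ∈ U, P s u ≤ ∑ s with s ∉ U, v s * ∑ u with u ∈ U, P s u :=
    Finset.single_le_sum (f := fun s => v s * ∑ u with u ∈ U, P s u)
      (fun t _ => mul_nonneg (hv t) (Finset.sum_nonneg fun u _ => hP.nonneg t u)) (by simpa)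
  have h2 : P s s' ≤ ∑ u with u ∈ U, P s u :=
    Finset.single_le_sum (f := fun u => P s u) (fun u _ => hP.nonneg s u) (by simpa)
  have h3 : 0 < v s * ∑ u with u ∈ U, P s u := mul_pos hvs (hpos.trans_le h2)
  linarith

/-- Edges in the support of a stationary vector can be travelled back. -/
theorem IsKernel.reach_back (hP : IsKernel P) {x : S → ℝ} (hx : ∀ s, 0 ≤ x s)
    (hst : push P x = x) {s s' : S} (hs : 0 < x s) (he : 0 < P s s') :
    Relation.ReflTransGen (fun s s' => 0 < P s s') s' s := by
  by_contra h
  -- The descendants of `s'` form a closed set, which a stationary vector cannot enter.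
  exact hP.no_inflow (U := {t | Relation.ReflTransGen (fun s s' => 0 < P s s') s' t})
    (fun t ht u hu => ht.tail hu) hx (by rw [hst]) s h s' .refl hs he

theorem IsKernel.pos_of_reach (hP : IsKernel P) {x : S → ℝ} (hx : ∀ s, 0 ≤ x s)
    (hst : push P x = x) {s s' : S} (hs : 0 < x s)
    (h : Relation.ReflTransGen (fun s s' => 0 < P s s') s s') : 0 < x s' := by
  induction h with
  | refl => exact hs
  | tail _ he ih => rw [← hst]; exact hP.push_pos hx ih he

theorem IsKernel.reach_symm (hP : IsKernel P) {x : S → ℝ} (hx : ∀ s, 0 ≤ x s)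
    (hst : push P x = x) {s s' : S} (hs : 0 < x s)
    (h : Relation.ReflTransGen (fun s s' => 0 < P s s') s s') :
    Relation.ReflTransGen (fun s s' => 0 < P s s') s' s := by
  induction h with
  | refl => exact .refl
  | tail h' he ih => exact (hP.reach_back hx hst (hP.pos_of_reach hx hst hs h') he).trans ih

/-- Harmonic functions are constant on closed strongly connected sets. -/
theorem IsKernel.harmonic_const (hP : IsKernel P) {C : Set S}
    (hC : ∀ s ∈ C, ∀ s', 0 < P s s' → s' ∈ C)
    (hconn : ∀ s ∈ C, ∀ s' ∈ C, Relation.ReflTransGen (fun s s' => 0 < P s s') s s')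
    {h : S → ℝ} (hh : ∀ s, ∑ s', P s s' * h s' = h s) : ∀ s ∈ C, ∀ s' ∈ C, h s = h s' := by
  suffices H : ∃ c, ∀ s ∈ C, h s = c by
    obtain ⟨c, hc⟩ := H
    intro s hs s' hs'
    rw [hc s hs, hc s' hs']
  rcases C.eq_empty_or_nonempty with rfl | hne
  · exact ⟨0, by simp⟩
  obtain ⟨m, hm, hmax⟩ := C.toFinite.exists_maximalFor h C hne
  have hle : ∀ s ∈ C, h s ≤ h m := fun s hs => by
    by_contra hlt
    exact hlt (hmax hs (not_le.1 hlt).le)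
  refine ⟨h m, fun s hs => ?_⟩
  have hr := hconn m hm s hs
  clear hs
  suffices h s = h m ∧ s ∈ C from this.1
  induction hr with
  | refl => exact ⟨rfl, hm⟩
  | @tail s t _ he ih =>
    obtain ⟨ih, hs⟩ := ih
    refine ⟨?_, hC s hs t he⟩
    -- Maximum principle: where `h` attains its maximum over `C`, the nonnegative defects `h m - h
    -- s'` average to zero, so every successor attains it too.
    have hsum : ∑ s', P s s' * (h m - h s') = 0 := by
      simp only [mul_sub, Finset.sum_sub_distrib, ← Finset.sum_mul, hP.sum_eq, hh]
      rw [ih]; ring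
    have hnn : ∀ s' ∈ Finset.univ, 0 ≤ P s s' * (h m - h s') := by
      intro s' _
      rcases (hP.nonneg s s').eq_or_lt with h0 | h0
      · simp [← h0]
      · exact mul_nonneg h0.le (sub_nonneg.2 (hle s' (hC s hs s' h0)))
    have := (Finset.sum_eq_zero_iff_of_nonneg hnn).1 hsum t (Finset.mem_univ t)
    rcases mul_eq_zero.1 this with h0 | h0
    · exact absurd h0 he.ne'
    · linarith

/-- The linear map `w ↦ w - w P`. -/
noncomputable def subPush (P : S → S → ℝ) : (S → ℝ) →ₗ[ℝ] (S → ℝ) where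
  toFun w := w - push P w
  map_add' v w := by ext s; simp [push, add_mul, Finset.sum_add_distrib]; ring
  map_smul' c w := by ext s; simp [push, mul_sub, Finset.mul_sum, mul_assoc]

/-- A row vector that is orthogonal to the harmonic functions lies in the range of `1 - P`. -/
theorem exists_sub_push_eq {d : S → ℝ}
    (hd : ∀ h : S → ℝ, (∀ s, ∑ s', P s s' * h s' = h s) → ∑ s, d s * h s = 0) :
    ∃ w, w - push P w = d := by
  by_contra hne
  have hnot : d ∉ LinearMap.range (subPush P) := fun ⟨w, hw⟩ => hne ⟨w, hw⟩
  -- A functional that kills the range of `1 - P` but not `d` has harmonic coordinates, which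
  -- contradicts the orthogonality.
  obtain ⟨φ, hφd, hφ⟩ := Submodule.exists_le_ker_of_notMem hnot
  have hrep : ∀ v, φ v = ∑ s, v s * φ (Pi.single s 1) := by
    intro v
    conv_lhs => rw [← Finset.univ_sum_single v]
    rw [map_sum]
    refine Finset.sum_congr rfl fun s _ => ?_
    rw [← smul_eq_mul, ← map_smul, ← Pi.single_smul, smul_eq_mul, mul_one]
  apply hφd
  rw [hrep]
  apply hd
  intro s
  have : φ (subPush P (Pi.single s 1)) = 0 := hφ ⟨_, rfl⟩
  have h2 : push P (Pi.single s 1) = P s := by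
    ext t; simp [push, Pi.single_apply]
  simp only [subPush, LinearMap.coe_mk, AddHom.coe_mk, map_sub, h2] at this
  rw [hrep (P s)] at this
  linarith

end Kernel

/-! ### Closedness of finitely generated cones -/

section Cone

open scoped Classical

/-- A finitely generated cone, given as the linear image of a coordinate orthant, is closed. -/
theorem isClosed_image_orthant {ι F : Type*} [Fintype ι] [NormedAddCommGroup F] [NormedSpace ℝ F]
    (L : (ι → ℝ) →ₗ[ℝ] F) (J : Finset ι) :
    IsClosed (L '' {y | (∀ i, 0 ≤ y i) ∧ ∀ i, i ∉ J → y i = 0}) := by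
  induction J using Finset.strongInduction with
  | H J ih =>
  let V : Submodule ℝ (ι → ℝ) :=
    { carrier := {y | ∀ i, i ∉ J → y i = 0}
      add_mem' := fun {a b} ha hb i hi => by simp [ha i hi, hb i hi]
      zero_mem' := fun i _ => rfl
      smul_mem' := fun c a ha i hi => by simp [ha i hi] }
  -- If `L` is injective on the coordinates in `J`, it is a closed embedding there. Otherwise a
  -- kernel vector removes one coordinate from any representation (conic Carathéodory), and the
  -- image is a finite union of smaller cones.
  by_cases hinj : LinearMap.ker (L.comp V.subtype) = ⊥
  · have hemb := LinearMap.isClosedEmbedding_of_injective hinj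
    have hcl : IsClosed {y : V | ∀ i, 0 ≤ (y : ι → ℝ) i} := by
      simp only [Set.ofPred_forall]
      exact isClosed_iInter fun i =>
        isClosed_le continuous_const ((continuous_apply i).comp continuous_subtype_val)
    convert hemb.isClosedMap _ hcl using 1
    ext b
    constructor
    · rintro ⟨y, ⟨h0, hJ⟩, rfl⟩
      exact ⟨⟨y, hJ⟩, h0, rfl⟩
    · rintro ⟨⟨y, hJ⟩, h0, rfl⟩
      exact ⟨y, ⟨h0, hJ⟩, rfl⟩
  · obtain ⟨v, hvJ, hLv, j₀, hj₀⟩ : ∃ v : ι → ℝ, (∀ i, i ∉ J → v i = 0) ∧ L v = 0 ∧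
        ∃ j, 0 < v j := by
      obtain ⟨⟨v, hvJ⟩, hv, hv0⟩ := (Submodule.ne_bot_iff _).1 hinj
      have hLv : L v = 0 := hv
      have hne : v ≠ 0 := fun h => hv0 (Subtype.ext h)
      obtain ⟨j, hj⟩ := Function.ne_iff.1 hne
      rcases lt_or_gt_of_ne hj with h | h
      · exact ⟨-v, fun i hi => by simp [hvJ i hi], by simp [hLv], j, by simpa using h⟩
      · exact ⟨v, hvJ, hLv, j, h⟩
    have hUnion : L '' {y | (∀ i, 0 ≤ y i) ∧ ∀ i, i ∉ J → y i = 0} =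
        ⋃ j ∈ J, L '' {y | (∀ i, 0 ≤ y i) ∧ ∀ i, i ∉ J.erase j → y i = 0} := by
      ext b
      simp only [Set.mem_iUnion]
      constructor
      · rintro ⟨y, ⟨h0, hJ⟩, rfl⟩
        have hne : (Finset.univ.filter fun i => 0 < v i).Nonempty := ⟨j₀, by simpa using hj₀⟩
        -- The least ratio is the largest multiple of `v` that can be subtracted without leaving the
        -- orthant; it makes coordinate `j` vanish.
        obtain ⟨j, hj, hmin⟩ := Finset.exists_min_image _ (fun i => y i / v i) hne
        have hvj : 0 < v j := by simpa using hj
        have hjJ : j ∈ J := by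
          by_contra h
          exact hvj.ne' (hvJ j h)
        have hrat : 0 ≤ y j / v j := div_nonneg (h0 j) hvj.le
        refine ⟨j, hjJ, y - (y j / v j) • v, ⟨fun i => ?_, fun i hi => ?_⟩, by simp [hLv]⟩
        · simp only [Pi.sub_apply, Pi.smul_apply, smul_eq_mul, sub_nonneg]
          rcases le_or_gt (v i) 0 with h | h
          · exact (mul_nonpos_of_nonneg_of_nonpos hrat h).trans (h0 i)
          · exact (le_div_iff₀ h).1 (hmin i (by simpa using h))
        · rcases eq_or_ne i j with rfl | hij
          · simp [hvj.ne']
          · have : i ∉ J := fun h => hi (Finset.mem_erase.2 ⟨hij, h⟩)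
            simp [hJ i this, hvJ i this]
      · rintro ⟨j, hj, y, ⟨h0, hJ⟩, rfl⟩
        exact ⟨y, ⟨h0, fun i hi => hJ i fun h => hi (Finset.mem_of_mem_erase h)⟩, rfl⟩
    rw [hUnion]
    exact J.finite_toSet.isClosed_biUnion fun j hj => ih _ (Finset.erase_ssubset hj)

end Cone

/-! ### Long-run averages of the laws of a chain -/

section Average

variable {S : Type*} [Fintype S] {P : S → S → ℝ} {ν : ℕ → S → ℝ} {p x w : S → ℝ}

/-- The average of the first `n` terms of `ν`, starting at time `1`. -/
noncomputable def average (ν : ℕ → S → ℝ) (n : ℕ) (s : S) : ℝ :=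
  (1 / (n : ℝ)) * ∑ t ∈ Finset.Icc 1 n, ν t s

theorem IsKernel.sum_abs_push_le (hP : IsKernel P) (v : S → ℝ) :
    ∑ s, |push P v s| ≤ ∑ s, |v s| := by
  rw [← hP.sum_push fun s => |v s|]
  refine Finset.sum_le_sum fun s _ => (Finset.abs_sum_le_sum_abs _ _).trans_eq ?_
  exact Finset.sum_congr rfl fun t _ => by rw [abs_mul, abs_of_nonneg (hP.nonneg t s)]

theorem IsKernel.abs_le_of_step (hP : IsKernel P) (hν : ∀ t, ν (t + 1) = push P (ν t)) (t : ℕ)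
    (s : S) : |ν t s| ≤ ∑ s, |ν 0 s| := by
  have h : ∑ s, |ν t s| ≤ ∑ s, |ν 0 s| := by
    induction t with
    | zero => exact le_rfl
    | succ t ih => rw [hν]; exact (hP.sum_abs_push_le _).trans ih
  exact (Finset.single_le_sum (f := fun s => |ν t s|) (fun _ _ => abs_nonneg _)
    (Finset.mem_univ s)).trans h

/-- A kernel contracts the `ℓ¹` norm, so orbits are bounded, including those of signed vectors, and
the ends of a telescoped sum disappear after division by `n`. -/
theorem IsKernel.tendsto_sub_div (hP : IsKernel P) (hν : ∀ t, ν (t + 1) = push P (ν t)) (s : S) :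
    Tendsto (fun n : ℕ => (1 / (n : ℝ)) * (ν 1 s - ν (n + 1) s)) atTop (𝓝 0) := by
  refine squeeze_zero_norm (a := fun n : ℕ => (1 / (n : ℝ)) * (2 * ∑ s, |ν 0 s|)) (fun n => ?_) ?_
  · rw [norm_mul, Real.norm_of_nonneg (by positivity), Real.norm_eq_abs]
    gcongr
    have h1 := hP.abs_le_of_step hν 1 s
    have h2 := hP.abs_le_of_step hν (n + 1) s
    have h3 := abs_sub (ν 1 s) (ν (n + 1) s)
    linarith
  · simpa using tendsto_one_div_atTop_nhds_zero_nat.mul_const (2 * ∑ s, |ν 0 s|)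

theorem sum_Icc_telescope (a : ℕ → ℝ) (n : ℕ) :
    ∑ t ∈ Finset.Icc 1 n, (a t - a (t + 1)) = a 1 - a (n + 1) := by
  induction n with
  | zero => simp
  | succ n ih => rw [Finset.sum_Icc_succ_top (by omega), ih]; ring

/-- If the initial law differs from a stationary vector `x` by an element of the range of `1 - P`,
then the averaged laws tend to `x`. -/
theorem IsKernel.tendsto_average (hP : IsKernel P) (hν : ∀ t, ν (t + 1) = push P (ν t))
    (hx : push P x = x) (hw : w - push P w = ν 0 - x) (s : S) :
    Tendsto (fun n => average ν n s) atTop (𝓝 (x s)) := by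
  set ω : ℕ → S → ℝ := fun t => (push P)^[t] w with hω
  have hstep : ∀ t, ω (t + 1) = push P (ω t) := fun t => Function.iterate_succ_apply' _ _ _
  -- Since `x` is stationary, applying `P` repeatedly to `hw` writes `ν t - x` as a difference of
  -- consecutive terms of the orbit of `w`.
  have hdiff : ∀ t, ν t - x = ω t - ω (t + 1) := by
    intro t
    induction t with
    | zero => rw [← hw]; rfl
    | succ t ih =>
      rw [hν, hstep (t + 1)]
      nth_rewrite 1 [← hx]
      nth_rewrite 1 [hstep t]
      rw [← push_sub, ih, push_sub]
  have hlim := (hP.tendsto_sub_div hstep s).const_add (x s)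
  rw [add_zero] at hlim
  refine hlim.congr' ?_
  filter_upwards [eventually_ge_atTop 1] with n hn
  have hn' : (n : ℝ) ≠ 0 := by positivity
  have : ∀ t, ν t s = x s + (ω t s - ω (t + 1) s) := fun t => by
    have := congrFun (hdiff t) s
    simp only [Pi.sub_apply] at this
    linarith
  simp only [average, this, Finset.sum_add_distrib]
  rw [sum_Icc_telescope fun t => ω t s]
  simp only [Finset.sum_const, Nat.card_Icc, Nat.add_sub_cancel, nsmul_eq_mul]
  field_simp

theorem push_average (hν : ∀ t, ν (t + 1) = push P (ν t)) (n : ℕ) (s : S) :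
    push P (average ν n) s = (1 / (n : ℝ)) * ∑ t ∈ Finset.Icc 1 n, ν (t + 1) s := by
  simp only [average, push, hν, Finset.sum_mul, Finset.mul_sum]
  rw [Finset.sum_comm]
  simp only [mul_assoc]

theorem tendsto_push {u : ℕ → S → ℝ} (h : ∀ s, Tendsto (fun n => u n s) atTop (𝓝 (p s))) (s : S) :
    Tendsto (fun n => push P (u n) s) atTop (𝓝 (push P p s)) :=
  tendsto_finsetSum _ fun t _ => (h t).mul_const _

/-- The limit of the averaged laws is stationary. -/
theorem IsKernel.push_limit (hP : IsKernel P) (hν : ∀ t, ν (t + 1) = push P (ν t))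
    (hp : ∀ s, Tendsto (fun n => average ν n s) atTop (𝓝 (p s))) : push P p = p := by
  ext s
  refine tendsto_nhds_unique (tendsto_push hp s) ?_
  have h := (hp s).sub (hP.tendsto_sub_div hν s)
  rw [sub_zero] at h
  refine h.congr fun n => ?_
  rw [push_average hν, average, ← mul_sub, ← sum_Icc_telescope fun t => ν t s,
    ← Finset.sum_sub_distrib]
  simp

/-- The difference of the initial law and the limit of the averaged laws is of the form `y - y P`
with a nonnegative vector `y`. -/
theorem exists_visits (hν : ∀ t, ν (t + 1) = push P (ν t))
    (h0 : ∀ t s, 0 ≤ ν t s) (hp : ∀ s, Tendsto (fun n => average ν n s) atTop (𝓝 (p s))) :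
    ∃ y, (∀ s, 0 ≤ y s) ∧ y - push P y = ν 0 - p := by
  -- The visit vectors for finite `n` may be unbounded; only their images under `1 - P` converge, so
  -- the closedness of the cone supplies the limiting `y`.
  have hcl := isClosed_image_orthant (subPush P) Finset.univ
  have hmem : ν 0 - p ∈ subPush P '' {y | (∀ i, 0 ≤ y i) ∧ ∀ i, i ∉ Finset.univ → y i = 0} := by
    have hlim : Tendsto (fun n => ν 0 - average ν n) atTop (𝓝 (ν 0 - p)) :=
      (tendsto_pi_nhds.2 hp).const_sub _
    refine hcl.mem_of_tendsto hlim ?_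
    filter_upwards [eventually_ge_atTop 1] with n hn
    have hn' : (n : ℝ) ≠ 0 := by positivity
    -- The partial sum of the laws before time `t` is mapped by `1 - P` to `ν 0 - ν t`; averaging
    -- over `t` gives the required image.
    refine ⟨average (fun t => ∑ i ∈ Finset.range t, ν i) n, ⟨fun s => ?_, by simp⟩, ?_⟩
    · simp only [average, Finset.sum_apply]
      exact mul_nonneg (by positivity)
        (Finset.sum_nonneg fun t _ => Finset.sum_nonneg fun i _ => h0 i s)
    · have hL : ∀ t, subPush P (∑ i ∈ Finset.range t, ν i) = ν 0 - ν t := by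
        intro t
        rw [map_sum, ← Finset.sum_range_sub' ν t]
        exact Finset.sum_congr rfl fun i _ => by rw [hν]; rfl
      have hav : ∀ μ : ℕ → S → ℝ, average μ n = (1 / (n : ℝ)) • ∑ t ∈ Finset.Icc 1 n, μ t := by
        intro μ; ext s; simp [average]
      rw [hav, map_smul, map_sum, hav]
      simp only [hL, Finset.sum_sub_distrib, smul_sub, Finset.sum_const, Nat.card_Icc,
        Nat.add_sub_cancel]
      congr 1
      ext s
      simp [hn']
  obtain ⟨y, ⟨hy, -⟩, h⟩ := hmem
  exact ⟨y, hy, h⟩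

end Average

/-! ### Stationary vectors coupled with expected visits -/

section FlowPair

open scoped Classical

variable {S : Type*} [Fintype S]

/-- A stationary vector `x` of the kernel `P` and a vector `y` of expected visits, which moves by
the kernel `Q`, for the initial law `β`. The sets in `K` are the recurrent classes; outside of
them, `x` vanishes, and `P` and `Q` agree where `y` is positive. -/
structure FlowPair (P Q : S → S → ℝ) (β x y : S → ℝ) (K : Set S → Prop) : Prop where
  kernelP : IsKernel P
  kernelQ : IsKernel Q
  β_nonneg : ∀ s, 0 ≤ β s
  x_nonneg : ∀ s, 0 ≤ x s
  y_nonneg : ∀ s, 0 ≤ y s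
  stationary : push P x = x
  visits : ∀ s, push Q y s = x s + y s - β s
  x_eq_zero : ∀ s, (∀ C, K C → s ∉ C) → x s = 0
  agree : ∀ s, (∀ C, K C → s ∉ C) → 0 < y s → P s = Q s
  closedP : ∀ C, K C → ∀ s ∈ C, ∀ s', 0 < P s s' → s' ∈ C
  closedQ : ∀ C, K C → ∀ s ∈ C, ∀ s', 0 < Q s s' → s' ∈ C

namespace FlowPair

variable {P Q : S → S → ℝ} {β x y : S → ℝ} {K : Set S → Prop}

/-- Where `x` vanishes, the visit equation reads `y = β + y Q`, so positivity starts on the support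
of `β` and spreads along edges. Classes are closed, so a transient state is entered only from
transient ones, where `P` and `Q` agree. -/
theorem visits_pos (h : FlowPair P Q β x y K) : ∀ s ∈ reachable (fun s s' => 0 < P s s') β,
    (∀ C, K C → s ∉ C) → 0 < y s := by
  refine reachable_induction (fun s hs hsK => ?_) fun s _ ih s' he hsK => ?_
  · have h1 := h.visits s
    have h2 := h.kernelQ.push_nonneg h.y_nonneg s
    rw [h.x_eq_zero s hsK] at h1
    linarith
  · have hs : ∀ C, K C → s ∉ C := fun C hC hsC => hsK C hC (h.closedP C hC s hsC s' he)
    rw [h.agree s hs (ih hs)] at he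
    have h1 := h.visits s'
    have h2 := h.kernelQ.push_pos h.y_nonneg (ih hs) he
    have h3 := h.β_nonneg s'
    rw [h.x_eq_zero s' hsK] at h1
    linarith

/-- A closed set that contains a reachable state, and can be entered only from transient states,
carries mass of `x`. -/
theorem exists_pos (h : FlowPair P Q β x y K) {U : Set S}
    (hU : ∀ s ∈ U, ∀ s', 0 < Q s s' → s' ∈ U)
    (hr : ∃ s ∈ U, s ∈ reachable (fun s s' => 0 < P s s') β)
    (henter : ∀ s ∉ U, ∀ s' ∈ U, 0 < P s s' → ∀ C, K C → s ∉ C) : ∃ s ∈ U, 0 < x s := by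
  by_contra! hx
  have hx0 : ∀ s ∈ U, x s = 0 := fun s hs => le_antisymm (hx s hs) (h.x_nonneg s)
  -- Without mass of `x` on `U`, the visit equation leaves no room for initial mass or inflow there,
  -- so no path from the support of `β` can get in.
  have hsum : ∑ s with s ∈ U, push Q y s = ∑ s with s ∈ U, y s - ∑ s with s ∈ U, β s := by
    rw [← Finset.sum_sub_distrib]
    refine Finset.sum_congr rfl fun s hs => ?_
    rw [h.visits, hx0 s (by simpa using hs), zero_add]
  have hβ : 0 ≤ ∑ s with s ∈ U, β s := Finset.sum_nonneg fun s _ => h.β_nonneg s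
  have hin := h.kernelQ.no_inflow hU h.y_nonneg (by linarith)
  have hβ0 : ∀ s ∈ U, β s ≤ 0 := by
    intro s hs
    have hb := h.kernelQ.sum_push_closed hU y
    have : 0 ≤ ∑ s with s ∉ U, y s * ∑ u with u ∈ U, Q s u :=
      Finset.sum_nonneg fun t _ =>
        mul_nonneg (h.y_nonneg t) (Finset.sum_nonneg fun u _ => h.kernelQ.nonneg t u)
    have h1 : β s ≤ ∑ s with s ∈ U, β s :=
      Finset.single_le_sum (f := β) (fun t _ => h.β_nonneg t) (by simpa)
    linarith
  obtain ⟨s, hs, hsr⟩ := hr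
  refine reachable_induction (p := fun s => s ∉ U) (fun t ht htU => ?_) ?_ s hsr hs
  · exact (hβ0 t htU).not_gt ht
  · intro t htr htU t' he ht'
    have htK := henter t htU t' ht' he
    have hy := h.visits_pos t htr htK
    rw [h.agree t htK hy] at he
    exact hin t htU t' ht' hy he

/-- Every reachable closed set meets one of the recurrent classes. -/
theorem exists_class_inter (h : FlowPair P Q β x y K) {U : Set S} (hne : U.Nonempty)
    (hU : ∀ s ∈ U, ∀ s', 0 < P s s' → s' ∈ U)
    (hr : U ⊆ reachable (fun s s' => 0 < P s s') β) : ∃ C, K C ∧ ∃ s ∈ U, s ∈ C := by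
  by_contra! hdisj
  have hK : ∀ s ∈ U, ∀ C, K C → s ∉ C := fun s hs C hC => hdisj C hC s hs
  have hUQ : ∀ s ∈ U, ∀ s', 0 < Q s s' → s' ∈ U := by
    intro s hs s' he
    rw [← h.agree s (hK s hs) (h.visits_pos s (hr hs) (hK s hs))] at he
    exact hU s hs s' he
  obtain ⟨s, hs⟩ := hne
  obtain ⟨t, ht, hxt⟩ := h.exists_pos hUQ ⟨s, hs, hr hs⟩ fun s _ s' hs' he C hC hsC =>
    hK s' hs' C hC (h.closedP C hC s hsC s' he)
  exact hxt.ne' (h.x_eq_zero t (hK t ht))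

/-- Every recurrent class that carries mass of `x` is reachable. -/
theorem exists_reachable (h : FlowPair P Q β x y K)
    (hdisj : ∀ C D, K C → K D → ∀ s ∈ C, s ∈ D → C = D) {C : Set S} (hC : K C)
    (hx : ∃ s ∈ C, 0 < x s) : ∃ s ∈ C, s ∈ reachable (fun s s' => 0 < P s s') β := by
  by_contra! hnr
  -- `y` may also be positive at unreachable transient states. `F` isolates these: it is `Q`-closed
  -- and carries all of `x` and of `β`, whose totals are equal, so nothing flows into it.
  obtain ⟨F, hF⟩ : ∃ F : Set S, ∀ s, s ∈ F ↔
      (∃ C, K C ∧ s ∈ C) ∨ s ∈ reachable (fun s s' => 0 < P s s') β := ⟨{s | _}, fun s => Iff.rfl⟩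
  have hFQ : ∀ s ∈ F, ∀ s', 0 < Q s s' → s' ∈ F := by
    intro s hs s' he
    by_cases hsK : ∃ C, K C ∧ s ∈ C
    · obtain ⟨C, hC, hsC⟩ := hsK
      exact (hF _).2 <| Or.inl ⟨C, hC, h.closedQ C hC s hsC s' he⟩
    · have hsr := ((hF s).1 hs).resolve_left hsK
      push Not at hsK
      rw [← h.agree s hsK (h.visits_pos s hsr hsK)] at he
      exact (hF _).2 <| Or.inr (reachable_closed s hsr s' he)
  have hxF : ∑ s with s ∈ F, x s = ∑ s, x s := by
    refine Finset.sum_subset (Finset.filter_subset _ _) fun s _ hs => h.x_eq_zero s ?_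
    intro C hC hsC
    exact hs (by simpa using (hF s).2 (Or.inl ⟨C, hC, hsC⟩))
  have hβF : ∑ s with s ∈ F, β s = ∑ s, β s := by
    refine Finset.sum_subset (Finset.filter_subset _ _) fun s _ hs => ?_
    by_contra hβ
    have hpos : 0 < β s := lt_of_le_of_ne (h.β_nonneg s) (Ne.symm hβ)
    exact hs (by simpa using (hF s).2 (Or.inr ⟨s, hpos, .refl⟩))
  have htot : ∑ s, x s = ∑ s, β s := by
    have := h.kernelQ.sum_push y
    simp only [h.visits, Finset.sum_sub_distrib, Finset.sum_add_distrib] at this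
    linarith
  have hinF := h.kernelQ.no_inflow hFQ h.y_nonneg (by
    simp only [h.visits, Finset.sum_sub_distrib, Finset.sum_add_distrib]
    linarith)
  have hb := h.kernelQ.sum_push_closed (h.closedQ C hC) y
  simp only [h.visits, Finset.sum_sub_distrib, Finset.sum_add_distrib] at hb
  have hβC : ∑ s with s ∈ C, β s = 0 := Finset.sum_eq_zero fun s hs => by
    by_contra hβ
    exact hnr s (by simpa using hs) ⟨s, lt_of_le_of_ne (h.β_nonneg s) (Ne.symm hβ), .refl⟩
  have hxC : 0 < ∑ s with s ∈ C, x s := by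
    obtain ⟨s, hs, hxs⟩ := hx
    exact Finset.sum_pos' (fun t _ => h.x_nonneg t) ⟨s, by simpa, hxs⟩
  -- As `β` vanishes on `C`, the mass of `x` on `C` must be supplied by inflow of `y`. Its source
  -- lies in another class, which is closed, or is a reachable transient state, which would make `C`
  -- reachable, or lies outside `F`, where inflow is excluded.
  obtain ⟨s, hs, hpos⟩ : ∃ s ∈ Finset.univ.filter (fun s => s ∉ C),
      0 < y s * ∑ u with u ∈ C, Q s u := Finset.exists_lt_of_sum_lt (by simp; linarith)
  have hsC : s ∉ C := by simpa using hs
  have hys : 0 < y s := (h.y_nonneg s).lt_of_ne fun h0 => by simp [← h0] at hpos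
  obtain ⟨u, hu, hsu⟩ : ∃ u ∈ Finset.univ.filter (fun u => u ∈ C), 0 < Q s u :=
    Finset.exists_lt_of_sum_lt (f := fun _ => 0) (by
      simpa using (pos_iff_pos_of_mul_pos hpos).1 hys)
  have huC : u ∈ C := by simpa using hu
  by_cases hsF : s ∈ F
  · by_cases hsK : ∃ D, K D ∧ s ∈ D
    · obtain ⟨D, hD, hsD⟩ := hsK
      have := hdisj C D hC hD u huC (h.closedQ D hD s hsD u hsu)
      exact hsC (this ▸ hsD)
    · have hsr := ((hF s).1 hsF).resolve_left hsK
      push Not at hsK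
      rw [← h.agree s hsK hys] at hsu
      exact hnr u huC (reachable_closed s hsr u hsu)
  · exact hinF s hsF u ((hF u).2 (Or.inl ⟨C, hC, huC⟩)) hys hsu

/-- If the recurrent classes are strongly connected, then `x` is the long-run average of the laws
of the chain with initial law `β`. -/
theorem tendsto_average (h : FlowPair P Q β x y K)
    (hconn : ∀ C, K C → ∀ s ∈ C, ∀ s' ∈ C,
      Relation.ReflTransGen (fun s s' => 0 < P s s') s s')
    {ν : ℕ → S → ℝ} (h0 : ν 0 = β) (hν : ∀ t, ν (t + 1) = push P (ν t)) (s : S) :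
    Tendsto (fun n => average ν n s) atTop (𝓝 (x s)) := by
  obtain ⟨w, hw⟩ : ∃ w, w - push P w = ν 0 - x := by
    refine exists_sub_push_eq fun g hg => ?_
    -- By the visit equation, the pairing of `β - x` with `g` is the sum of these terms. On a class
    -- `g` is constant; elsewhere `Q` is `P` wherever `y > 0`.
    have hterm : ∀ s, y s * (g s - ∑ s', Q s s' * g s') = 0 := by
      intro s
      by_cases hsK : ∃ C, K C ∧ s ∈ C
      · obtain ⟨C, hC, hsC⟩ := hsK
        have : ∑ s', Q s s' * g s' = g s := by
          rw [← one_mul (g s), ← h.kernelQ.sum_eq s, Finset.sum_mul]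
          refine Finset.sum_congr rfl fun s' _ => ?_
          rcases (h.kernelQ.nonneg s s').eq_or_lt with h0 | h0
          · simp [← h0]
          · rw [h.kernelP.harmonic_const (h.closedP C hC) (hconn C hC) hg s'
              (h.closedQ C hC s hsC s' h0) s hsC]
        simp [this]
      · push Not at hsK
        rcases (h.y_nonneg s).eq_or_lt with hy | hy
        · simp [← hy]
        · rw [← h.agree s hsK hy, hg]; simp
    have hsum := sum_push_mul (P := Q) y g
    simp only [h.visits] at hsum
    have h2 := Finset.sum_eq_zero fun s (_ : s ∈ Finset.univ) => hterm s
    simp only [mul_sub, Finset.sum_sub_distrib] at h2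
    simp only [sub_mul, add_mul, Finset.sum_sub_distrib, Finset.sum_add_distrib] at hsum
    simp only [h0, Pi.sub_apply, sub_mul, Finset.sum_sub_distrib]
    linarith
  exact h.kernelP.tendsto_average hν h.stationary hw s

end FlowPair

end FlowPair

/-! ### From points of `Q₀` to derived policies -/

namespace MDP

open scoped Classical

variable {S A : Type*} [Fintype S] {M : MDP S A} {π π₀ x y p : S → A → ℝ} {C : Set S}

/-- The state marginal `x_s = ∑ a ∈ A(s), x_sa`. -/
noncomputable def mass (M : MDP S A) (x : S → A → ℝ) (s : S) : ℝ := ∑ a ∈ M.act s, x s a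

theorem exists_isStationaryPolicy (M : MDP S A) : ∃ π, M.IsStationaryPolicy π := by
  choose f hf using M.act_nonempty
  refine ⟨fun s => Pi.single (f s) 1, fun s => ⟨fun a => ?_, fun a ha => ?_, ?_⟩⟩
  · by_cases h : a = f s
    · subst h; simp
    · simp [h]
  · have : a ≠ f s := fun h => ha (h ▸ hf s)
    simp [this]
  · simp [Pi.single_apply, hf]

theorem IsStationaryPolicy.isKernel (hπ : M.IsStationaryPolicy π) : IsKernel (M.inducedT π) where
  nonneg s s' := Finset.sum_nonneg fun a ha => mul_nonneg (M.T_nonneg s a ha s') ((hπ s).1 a)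
  sum_eq s := by
    simp only [inducedT]
    rw [Finset.sum_comm, ← (hπ s).2.2]
    refine Finset.sum_congr rfl fun a ha => ?_
    rw [← Finset.sum_mul, M.T_sum s a ha, one_mul]

theorem IsStationaryPolicy.edge (hπ : M.IsStationaryPolicy π) {s s' : S}
    (h : 0 < M.inducedT π s s') : M.Edge s s' := by
  obtain ⟨a, ha, hpos⟩ := Finset.exists_lt_of_sum_lt (f := fun _ => (0 : ℝ))
    (by simpa [inducedT] using h)
  exact ⟨a, ha, (pos_iff_pos_of_mul_pos hpos).2 <|
    ((hπ s).1 a).lt_of_ne fun h0 => by simp [← h0] at hpos⟩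

theorem stateProb_succ (M : MDP S A) (π : S → A → ℝ) (t : ℕ) :
    M.stateProb π (t + 1) = push (M.inducedT π) (M.stateProb π t) := rfl

theorem IsStationaryPolicy.stateProb_nonneg (hπ : M.IsStationaryPolicy π) (t : ℕ) (s : S) :
    0 ≤ M.stateProb π t s := by
  induction t generalizing s with
  | zero => exact M.β_nonneg s
  | succ t ih => exact hπ.isKernel.push_nonneg ih s

theorem IsStationaryPolicy.sum_stateProb (hπ : M.IsStationaryPolicy π) (t : ℕ) :
    ∑ s, M.stateProb π t s = 1 := by
  induction t with
  | zero => exact M.β_sum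
  | succ t ih => rw [stateProb_succ, hπ.isKernel.sum_push, ih]

/-- If `x s a = x_s π(a | s)`, then the state-action flow of `x` is the flow of its marginal. -/
theorem push_mass (h : ∀ s, ∀ a ∈ M.act s, x s a = M.mass x s * π s a) (s' : S) :
    push (M.inducedT π) (M.mass x) s' = ∑ s, ∑ a ∈ M.act s, x s a * M.T s a s' := by
  simp only [push, inducedT, Finset.mul_sum]
  refine Finset.sum_congr rfl fun s _ => Finset.sum_congr rfl fun a ha => ?_
  rw [h s a ha]; ring

theorem mass_mul_inducedT (h : ∀ s, ∀ a ∈ M.act s, x s a = M.mass x s * π s a) (s s' : S) :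
    ∑ a ∈ M.act s, M.T s a s' * x s a = M.mass x s * M.inducedT π s s' := by
  rw [inducedT, Finset.mul_sum]
  refine Finset.sum_congr rfl fun a ha => ?_
  rw [h s a ha]; ring

theorem derivedPolicy_isStationaryPolicy (hx : ∀ s, ∀ a ∈ M.act s, 0 ≤ x s a)
    (hy : ∀ s, ∀ a ∈ M.act s, 0 ≤ y s a) (h₀ : M.IsStationaryPolicy π₀) :
    M.IsStationaryPolicy (M.derivedPolicy x y π₀) := by
  intro s
  refine ⟨fun a => ?_, fun a ha => by simp [derivedPolicy, ha], ?_⟩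
  · unfold derivedPolicy
    split_ifs with ha h1 h2
    · exact div_nonneg (hx s a ha) h1.le
    · exact div_nonneg (hy s a ha) h2.le
    · exact (h₀ s).1 a
    · exact le_rfl
  · have : ∀ a ∈ M.act s, M.derivedPolicy x y π₀ s a =
        if 0 < ∑ b ∈ M.act s, x s b then x s a / ∑ b ∈ M.act s, x s b
        else if 0 < ∑ b ∈ M.act s, y s b then y s a / ∑ b ∈ M.act s, y s b
        else π₀ s a := fun a ha => by simp [derivedPolicy, ha]
    rw [Finset.sum_congr rfl this]
    split_ifs with h1 h2
    · rw [← Finset.sum_div, div_self h1.ne']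
    · rw [← Finset.sum_div, div_self h2.ne']
    · exact (h₀ s).2.2

theorem mass_nonneg (hx : ∀ s, ∀ a ∈ M.act s, 0 ≤ x s a) (s : S) : 0 ≤ M.mass x s :=
  Finset.sum_nonneg (hx s)

theorem eq_zero_of_mass_eq_zero (hx : ∀ s, ∀ a ∈ M.act s, 0 ≤ x s a) {s : S}
    (h : M.mass x s = 0) : ∀ a ∈ M.act s, x s a = 0 :=
  (Finset.sum_eq_zero_iff_of_nonneg (hx s)).1 h

theorem eq_mass_mul_derivedPolicy (hx : ∀ s, ∀ a ∈ M.act s, 0 ≤ x s a) :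
    ∀ s, ∀ a ∈ M.act s, x s a = M.mass x s * M.derivedPolicy x y π₀ s a := by
  intro s a ha
  rcases (mass_nonneg hx s).eq_or_lt with h | h
  · rw [← h, zero_mul, eq_zero_of_mass_eq_zero hx h.symm a ha]
  · have h' : 0 < ∑ b ∈ M.act s, x s b := h
    simp only [derivedPolicy, ha, h', if_true, mass]
    field_simp

theorem derivedPolicy_zero_eq {s : S} (h : M.mass x s = 0) :
    M.derivedPolicy x y π₀ s = M.derivedPolicy 0 y π₀ s := by
  ext a
  have h' : ∑ b ∈ M.act s, x s b = 0 := h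
  simp [derivedPolicy, h']

theorem eq_mass_mul_derivedPolicy_zero (hy : ∀ s, ∀ a ∈ M.act s, 0 ≤ y s a) :
    ∀ s, ∀ a ∈ M.act s, y s a = M.mass y s * M.derivedPolicy 0 y π₀ s a := by
  intro s a ha
  rcases (mass_nonneg hy s).eq_or_lt with h | h
  · rw [← h, zero_mul, eq_zero_of_mass_eq_zero hy h.symm a ha]
  · have h' : 0 < ∑ b ∈ M.act s, y s b := h
    simp only [derivedPolicy, ha, h', if_true, mass]
    simp
    field_simp

theorem TSCC.closed (hC : M.TSCC C) : ∀ s ∈ C, ∀ s', M.Edge s s' → s' ∈ C :=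
  (isTSCC_iff.1 hC).2.1

namespace Q0

theorem x_nonneg (h : M.Q0 x y) : ∀ s, ∀ a ∈ M.act s, 0 ≤ x s a := fun s a ha => (h.x_mem s a ha).1

theorem mass_eq_zero (h : M.Q0 x y) {s : S} (hs : ∀ C, M.TSCC C → s ∉ C) : M.mass x s = 0 := by
  refine (Finset.sum_eq_zero_iff_of_nonneg fun s _ => mass_nonneg h.x_nonneg s).1 h.transient s ?_
  simp only [Set.Finite.mem_toFinset, Set.mem_compl_iff]
  rintro ⟨C, hC, hsC⟩
  exact hs C hC hsC

/-- On the terminal components the derived policy follows `x`, while `y` need not; `y` therefore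
moves by the policy derived from `(0, y)`. -/
theorem flowPair (h : M.Q0 x y) (h₀ : M.IsStationaryPolicy π₀) :
    FlowPair (M.inducedT (M.derivedPolicy x y π₀)) (M.inducedT (M.derivedPolicy 0 y π₀)) M.β
      (M.mass x) (M.mass y) M.TSCC :=
  have hP := derivedPolicy_isStationaryPolicy h.x_nonneg h.y_nonneg h₀
  have hQ := derivedPolicy_isStationaryPolicy (x := 0) (fun _ _ _ => le_rfl) h.y_nonneg h₀
  { kernelP := hP.isKernel
    kernelQ := hQ.isKernel
    β_nonneg := M.β_nonneg
    x_nonneg := mass_nonneg h.x_nonneg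
    y_nonneg := mass_nonneg h.y_nonneg
    stationary := by
      ext s'
      rw [push_mass (eq_mass_mul_derivedPolicy h.x_nonneg), h.stationary, mass]
    visits := fun s' => by
      rw [push_mass (eq_mass_mul_derivedPolicy_zero h.y_nonneg), h.visits,
        Finset.sum_add_distrib, mass, mass]
    x_eq_zero := fun s => h.mass_eq_zero
    agree := fun s hs _ => by
      ext s'
      simp only [inducedT, derivedPolicy_zero_eq (h.mass_eq_zero hs)]
    closedP := fun C hC s hs s' he => hC.closed s hs s' (hP.edge he)
    closedQ := fun C hC s hs s' he => hC.closed s hs s' (hQ.edge he) }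

/-- If `x` is positive on the terminal components and its support connects each of them, then the
derived policy is class-preserving and `x` is its steady-state distribution. -/
theorem derivedPolicy_spec (h : M.Q0 x y) (h₀ : M.IsStationaryPolicy π₀)
    (hpos : ∀ C, M.TSCC C → ∀ s ∈ C, 0 < M.mass x s)
    (hroot : ∀ C, M.TSCC C → ∃ z, ∀ s ∈ C,
      Relation.ReflTransGen (M.inducedEdge (M.derivedPolicy x y π₀)) s z) :
    M.derivedPolicy x y π₀ ∈ M.classPreserving ∧ M.IsSteadyState (M.derivedPolicy x y π₀) x := by
  have hP := derivedPolicy_isStationaryPolicy h.x_nonneg h.y_nonneg h₀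
  have hF := h.flowPair h₀
  have hconn : ∀ C, M.TSCC C → ∀ s ∈ C, ∀ s' ∈ C,
      Relation.ReflTransGen (M.inducedEdge (M.derivedPolicy x y π₀)) s s' := by
    intro C hC s hs s' hs'
    obtain ⟨z, hz⟩ := hroot C hC
    exact (hz s hs).trans
      (hF.kernelP.reach_symm hF.x_nonneg hF.stationary (hpos C hC s' hs') (hz s' hs'))
  have hinduced : ∀ C, M.TSCC C → M.inducedTSCC (M.derivedPolicy x y π₀) C := by
    intro C hC
    obtain ⟨s, hs, -⟩ := (isTSCC_iff.1 hC).2.2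
    exact isTSCC_iff.2 ⟨hconn C hC, hF.closedP C hC,
      hF.exists_reachable (fun C D hC hD s hsC hsD => IsTSCC.eq_of_mem hC hD hsC hsD) hC
        ⟨s, hs, hpos C hC s hs⟩⟩
  have hiff : ∀ C, M.inducedTSCC (M.derivedPolicy x y π₀) C ↔ M.TSCC C := by
    refine fun C => ⟨fun hC => ?_, hinduced C⟩
    obtain ⟨h1, h2, s, hs, s₀, hs₀, hr⟩ := isTSCC_iff.1 hC
    obtain ⟨D, hD, t, htC, htD⟩ := hF.exists_class_inter ⟨s, hs⟩ h2
      fun t ht => ⟨s₀, hs₀, hr.trans (h1 s hs t ht)⟩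
    -- A component of the induced chain meets a component of the MDP, which is itself one of the
    -- induced chain; overlapping components coincide.
    rwa [IsTSCC.eq_of_mem hC (hinduced D hD) htC htD]
  refine ⟨⟨hP, ?_, hiff⟩, ?_⟩
  · ext s
    exact exists_congr fun C => and_congr_left fun _ => hiff C
  · intro s a ha
    rw [eq_mass_mul_derivedPolicy (y := y) (π₀ := π₀) h.x_nonneg s a ha]
    refine ((hF.tendsto_average hconn (ν := M.stateProb (M.derivedPolicy x y π₀)) rfl
      (fun _ => rfl) s).mul_const _).congr fun n => ?_
    simp only [average, stateActionProb, ← Finset.sum_mul, mul_assoc]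

end Q0

/-- The average reward is the value of the steady-state distribution under the objective. -/
theorem avgReward_eq (hp : M.IsSteadyState π p) : M.avgReward π = M.objective p := by
  refine Tendsto.liminf_eq ?_
  have : Tendsto (fun n : ℕ => ∑ s, ∑ a ∈ M.act s, ((1 / (n : ℝ)) *
      ∑ t ∈ Finset.Icc 1 n, M.stateActionProb π t s a) * M.reward s a) atTop
      (𝓝 (M.objective p)) :=
    tendsto_finsetSum _ fun s _ => tendsto_finsetSum _ fun a ha => (hp s a ha).mul_const _
  refine this.congr fun n => ?_
  rw [Finset.sum_comm, Finset.mul_sum]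
  refine Finset.sum_congr rfl fun s _ => ?_
  rw [Finset.sum_comm, Finset.mul_sum]
  refine Finset.sum_congr rfl fun a _ => ?_
  rw [mul_assoc, Finset.sum_mul]

end MDP

/-! ### Consequences of the flow constraints -/

namespace LMDP

open scoped Classical

variable {S A : Type*} [Fintype S] {M : LMDP S A} {root : Set S → S} {π π₀ x y p : S → A → ℝ}
  {f frev : S → S → ℝ}

namespace LP2Feasible

/-- Reverse flow into `s` is capped by the mass that `x` sends out of `s`, so positive reverse
inflow needs positive mass at `s`. -/
theorem mass_pos (h : M.LP2Feasible root x y f frev) {C : Set S} (hC : M.TSCC C) :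
    ∀ s ∈ C, 0 < M.mass x s := by
  intro s hs
  obtain ⟨s', hs', hpos⟩ := Finset.exists_lt_of_sum_lt (f := fun _ => (0 : ℝ))
    (by simpa using h.flowRevIn C hC s hs)
  have hrel : M.TRel s s' := by simpa using hs'
  have hcap := h.flowRevCap C hC s' s ⟨hrel, hs, MDP.TSCC.closed hC s hs s' hrel.2⟩
  refine (MDP.mass_nonneg h.q0.x_nonneg s).lt_of_ne fun h0 => ?_
  rw [Finset.sum_eq_zero fun a ha => by
    rw [MDP.eq_zero_of_mass_eq_zero h.q0.x_nonneg h0.symm a ha, mul_zero]] at hcap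
  linarith

/-- Cut argument: no reverse flow enters the set `U` of states that cannot reach the root, yet each
of its states must receive more than it sends. -/
theorem reach_root (h : M.LP2Feasible root x y f frev) {C : Set S} (hC : M.TSCC C) :
    ∀ s ∈ C, Relation.ReflTransGen (M.inducedEdge (M.derivedPolicy x y π₀)) s (root C) := by
  by_contra! hne
  set E := M.inducedEdge (M.derivedPolicy x y π₀) with hE
  obtain ⟨U, hU⟩ : ∃ U : Finset S, ∀ s, s ∈ U ↔ s ∈ C ∧ ¬ Relation.ReflTransGen E s (root C) :=
    
    ⟨Finset.univ.filter fun s => s ∈ C ∧ ¬ Relation.ReflTransGen E s (root C), fun s => by simp⟩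
  have hstep : ∀ s ∈ U, ∀ s', M.TRel s s' → s' ∉ U → frev s' s ≤ 0 := by
    intro s hs s' hrel hs'
    obtain ⟨hsC, hsr⟩ := (hU s).1 hs
    have hs'C := MDP.TSCC.closed hC s hsC s' hrel.2
    have hcap := h.flowRevCap C hC s' s ⟨hrel, hsC, hs'C⟩
    rw [MDP.mass_mul_inducedT (MDP.eq_mass_mul_derivedPolicy (y := y) (π₀ := π₀) h.q0.x_nonneg)]
      at hcap
    by_contra! hpos
    have he : E s s' := (pos_iff_pos_of_mul_pos (hpos.trans_le hcap)).1 (h.mass_pos hC s hsC)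
    have hs'r : Relation.ReflTransGen E s' (root C) := by
      by_contra hn
      exact hs' ((hU s').2 ⟨hs'C, hn⟩)
    exact hsr (.head he hs'r)
  -- Summed over `U`, inflow exceeds outflow. But inflow is at most the flow inside `U`, and that is
  -- at most the outflow.
  have h1 : ∑ s ∈ U, ∑ s' with M.TRel s' s, frev s s' <
      ∑ s ∈ U, ∑ s' with M.TRel s s', frev s' s := by
    obtain ⟨s, hs, hsr⟩ := hne
    refine Finset.sum_lt_sum_of_nonempty ⟨s, (hU s).2 ⟨hs, hsr⟩⟩ fun t ht => ?_
    obtain ⟨htC, htr⟩ := (hU t).1 ht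
    exact h.flowRevTransfer C hC t htC fun h => htr (h ▸ .refl)
  have h2 : ∑ s ∈ U, ∑ s' with M.TRel s s', frev s' s ≤
      ∑ s ∈ U, ∑ s' ∈ U, if M.TRel s s' then frev s' s else 0 := by
    refine Finset.sum_le_sum fun s hs => ?_
    rw [Finset.sum_filter]
    refine Finset.sum_le_sum_of_subset_of_nonpos' (Finset.subset_univ U) fun s' _ hs' => ?_
    split_ifs with hrel
    · exact hstep s hs s' hrel hs'
    · exact le_rfl
  have h3 : ∑ s ∈ U, ∑ s' ∈ U, (if M.TRel s s' then frev s' s else 0) ≤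
      ∑ s ∈ U, ∑ s' with M.TRel s' s, frev s s' := by
    rw [Finset.sum_comm]
    refine Finset.sum_le_sum fun s hs => ?_
    rw [Finset.sum_filter]
    refine Finset.sum_le_sum_of_subset_of_nonneg (Finset.subset_univ U) fun s' _ _ => ?_
    split_ifs with hrel
    · exact (h.flowRev_mem s s' hrel).1
    · exact le_rfl
  linarith

end LP2Feasible

end LMDP

/-! ### Strictly lossy flows in a network -/

section Flow

open scoped Classical

variable {S : Type*} [Fintype S]

theorem exists_pos_lt_of_pos {ι : Type*} [Finite ι] (c : ι → ℝ) :
    ∃ ε : ℝ, 0 < ε ∧ ε < 1 ∧ ∀ i, 0 < c i → ε < c i := by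
  have h : ∀ᶠ ε in 𝓝[>] (0 : ℝ), 0 < ε ∧ ε < 1 ∧ ∀ i, 0 < c i → ε < c i := by
    refine eventually_mem_nhdsWithin.and (.and ?_ (eventually_all.2 fun i => ?_))
    · exact (eventually_lt_nhds one_pos).filter_mono nhdsWithin_le_nhds
    · by_cases hc : 0 < c i
      · filter_upwards [(eventually_lt_nhds hc).filter_mono nhdsWithin_le_nhds] with ε hε _
        exact hε
      · exact .of_forall fun ε h => absurd h hc
  exact h.exists

/-- In a network with capacities `c`, node weights `g` can be chosen such that the flow
`c s s' * g s` loses value at every node that is reachable from the sources `Z`. -/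
theorem exists_flow_weight {c : S → S → ℝ} (hc : ∀ s s', 0 ≤ c s s') (hrow : ∀ s, ∑ s', c s s' ≤ 1)
    {q : S → S → Prop} (hq : ∀ s s', s ≠ s' → 0 < c s s' → q s s') (Z : Set S) :
    ∃ g : S → ℝ, (∀ s, 0 < g s ∧ g s ≤ 1) ∧ (∀ s ∈ Z, g s = 1) ∧ ∀ s, s ∉ Z →
      (∃ z ∈ Z, Relation.ReflTransGen (fun s s' => 0 < c s s') z s) →
      ∑ s' with q s s', c s s' * g s < ∑ s' with q s' s, c s' s * g s' := by
  -- With `ε` below every positive capacity, one predecessor `u` with `g s = ε * g u` already brings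
  -- in more than `g s`, which bounds the outflow.
  obtain ⟨ε, h0, h1, hε⟩ := exists_pos_lt_of_pos fun i : S × S => c i.1 i.2
  obtain ⟨g, hg, hgZ, hdec⟩ := exists_decay_weight (fun s s' => 0 < c s s') Z h0 h1
  refine ⟨g, hg, hgZ, fun s hs hr => ?_⟩
  obtain ⟨u, hu, hgu⟩ := hdec s hs hr
  have hus : u ≠ s := by
    rintro rfl
    have := (hg u).1
    nlinarith
  calc ∑ s' with q s s', c s s' * g s
      ≤ (∑ s', c s s') * g s := by
        rw [Finset.sum_mul]
        exact Finset.sum_le_sum_of_subset_of_nonneg (Finset.filter_subset _ _)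
          fun s' _ _ => mul_nonneg (hc s s') (hg s).1.le
    _ ≤ 1 * g s := mul_le_mul_of_nonneg_right (hrow s) (hg s).1.le
    _ = ε * g u := by rw [one_mul, hgu]
    _ < c u s * g u := mul_lt_mul_of_pos_right (hε (u, s) hu) (hg u).1
    _ ≤ ∑ s' with q s' s, c s' s * g s' :=
        Finset.single_le_sum (f := fun s' => c s' s * g s')
          (fun s' _ => mul_nonneg (hc s' s) (hg s').1.le) (by simpa using hq u s hus hu)

end Flow

/-! ### From steady-state distributions to points of `Q₀` -/

namespace MDP

variable {S A : Type*} [Fintype S] {M : MDP S A} {π p : S → A → ℝ} {C : Set S}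

theorem IsStationaryPolicy.mass_mul (hπ : M.IsStationaryPolicy π) (v : S → ℝ) :
    M.mass (fun s a => v s * π s a) = v := by
  ext s
  simp only [mass]
  rw [← Finset.mul_sum, (hπ s).2.2, mul_one]

theorem IsSteadyState.tendsto_average (hp : M.IsSteadyState π p) (hπ : M.IsStationaryPolicy π)
    (s : S) : Tendsto (fun n => average (M.stateProb π) n s) atTop (𝓝 (M.mass p s)) := by
  refine (tendsto_finsetSum (M.act s) fun a ha => hp s a ha).congr fun n => ?_
  rw [← Finset.mul_sum, Finset.sum_comm, average]
  congr 1
  refine Finset.sum_congr rfl fun t _ => ?_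
  simp only [stateActionProb]
  rw [← Finset.mul_sum, (hπ s).2.2, mul_one]

theorem IsSteadyState.eq_mass_mul (hp : M.IsSteadyState π p) (hπ : M.IsStationaryPolicy π) :
    ∀ s, ∀ a ∈ M.act s, p s a = M.mass p s * π s a := by
  intro s a ha
  refine tendsto_nhds_unique (hp s a ha) (((hp.tendsto_average hπ s).mul_const _).congr fun n => ?_)
  simp only [average, stateActionProb, ← Finset.sum_mul, mul_assoc]

theorem IsSteadyState.push_mass_eq (hp : M.IsSteadyState π p) (hπ : M.IsStationaryPolicy π) :
    push (M.inducedT π) (M.mass p) = M.mass p :=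
  hπ.isKernel.push_limit (fun _ => rfl) (hp.tendsto_average hπ)

theorem IsSteadyState.mass_nonneg (hp : M.IsSteadyState π p) (hπ : M.IsStationaryPolicy π) (s : S) :
    0 ≤ M.mass p s :=
  ge_of_tendsto' (hp.tendsto_average hπ s) fun n =>
    mul_nonneg (by positivity) (Finset.sum_nonneg fun t _ => hπ.stateProb_nonneg t s)

theorem IsSteadyState.sum_mass (hp : M.IsSteadyState π p) (hπ : M.IsStationaryPolicy π) :
    ∑ s, M.mass p s = 1 := by
  obtain ⟨y, -, hy⟩ := exists_visits (fun _ => M.stateProb_succ π _) hπ.stateProb_nonneg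
    (hp.tendsto_average hπ)
  have h : ∑ s, (y - push (M.inducedT π) y) s = ∑ s, (M.stateProb π 0 - M.mass p) s := by rw [hy]
  simp only [Pi.sub_apply, Finset.sum_sub_distrib, hπ.isKernel.sum_push, hπ.sum_stateProb] at h
  linarith

theorem IsSteadyState.mass_le_one (hp : M.IsSteadyState π p) (hπ : M.IsStationaryPolicy π) (s : S) :
    M.mass p s ≤ 1 :=
  (Finset.single_le_sum (f := M.mass p) (fun t _ => hp.mass_nonneg hπ t)
    (Finset.mem_univ s)).trans_eq (hp.sum_mass hπ)

theorem IsStationaryPolicy.mem_reachable (hπ : M.IsStationaryPolicy π) {t : ℕ} {s : S}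
    (h : 0 < M.stateProb π t s) : s ∈ reachable (M.inducedEdge π) M.β := by
  induction t generalizing s with
  | zero => exact ⟨s, h, .refl⟩
  | succ t ih =>
    obtain ⟨u, -, hu⟩ := Finset.exists_lt_of_sum_lt (f := fun _ => (0 : ℝ))
      (by simpa [stateProb_succ, push] using h)
    have h1 : 0 < M.stateProb π t u :=
      (hπ.stateProb_nonneg t u).lt_of_ne fun h0 => by simp [← h0] at hu
    exact reachable_closed u (ih h1) s ((pos_iff_pos_of_mul_pos hu).1 h1)

/-- The descendants of `s` form the component: stationarity makes paths from `s` reversible, and if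
`s` were unreachable, its law would be zero at all times. -/
theorem IsSteadyState.exists_tscc (hp : M.IsSteadyState π p) (hπ : M.IsStationaryPolicy π) {s : S}
    (hs : 0 < M.mass p s) : ∃ C, M.inducedTSCC π C ∧ s ∈ C := by
  have hst := hp.push_mass_eq hπ
  have hback : ∀ t, Relation.ReflTransGen (M.inducedEdge π) s t →
      Relation.ReflTransGen (M.inducedEdge π) t s := fun t =>
    hπ.isKernel.reach_symm (hp.mass_nonneg hπ) hst hs
  refine ⟨{t | Relation.ReflTransGen (M.inducedEdge π) s t}, isTSCC_iff.2
    ⟨fun t ht t' ht' => (hback t ht).trans ht', fun t ht t' he => ht.tail he, s, .refl, ?_⟩, .refl⟩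
  by_contra hr
  refine hs.ne' (tendsto_nhds_unique (hp.tendsto_average hπ s) ?_)
  have h0 : ∀ t, M.stateProb π t s = 0 := fun t => by
    by_contra h
    exact hr (hπ.mem_reachable ((hπ.stateProb_nonneg t s).lt_of_ne (Ne.symm h)))
  simp [average, h0]

/-- The steady-state distribution of a class-preserving policy extends to a point of `Q₀`, and it is
positive on the terminal components. -/
theorem IsSteadyState.exists_Q0 (hp : M.IsSteadyState π p) (hπ : π ∈ M.classPreserving) :
    (∃ y, M.Q0 p y) ∧ ∀ C, M.TSCC C → ∀ s ∈ C, 0 < M.mass p s := by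
  obtain ⟨hπ, -, hiff⟩ := hπ
  have hst := hp.push_mass_eq hπ
  have hmul := hp.eq_mass_mul hπ
  have hzero : ∀ s, (∀ C, M.TSCC C → s ∉ C) → M.mass p s = 0 := by
    intro s hs
    by_contra h
    obtain ⟨C, hC, hsC⟩ := hp.exists_tscc hπ ((hp.mass_nonneg hπ s).lt_of_ne (Ne.symm h))
    exact hs C ((hiff C).1 hC) hsC
  obtain ⟨y, hy0, hy⟩ := exists_visits (fun _ => M.stateProb_succ π _) hπ.stateProb_nonneg
    (hp.tendsto_average hπ)
  have hvis : ∀ s, push (M.inducedT π) y s = M.mass p s + y s - M.β s := fun s => by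
    have h1 : y s - push (M.inducedT π) y s = M.β s - M.mass p s := congrFun hy s
    linarith
  have hclosed : ∀ C, M.TSCC C → ∀ s ∈ C, ∀ s', 0 < M.inducedT π s s' → s' ∈ C :=
    fun C hC s hs s' he => TSCC.closed hC s hs s' (hπ.edge he)
  have hF : FlowPair (M.inducedT π) (M.inducedT π) M.β (M.mass p) y M.TSCC :=
    ⟨hπ.isKernel, hπ.isKernel, M.β_nonneg, hp.mass_nonneg hπ, hy0, hst, hvis, hzero,
      fun _ _ _ => rfl, hclosed, hclosed⟩
  have hp0 : ∀ s, ∀ a ∈ M.act s, 0 ≤ p s a := fun s a ha => by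
    rw [hmul s a ha]; exact mul_nonneg (hp.mass_nonneg hπ s) ((hπ s).1 a)
  refine ⟨⟨fun s a => y s * π s a, ?_, ?_, ?_, ?_, ?_⟩, ?_⟩
  · intro s'
    rw [← push_mass hmul, hst, mass]
  · intro s'
    have hmass := hπ.mass_mul y
    rw [← push_mass (π := π) fun s a _ => by rw [hmass], hmass, hvis, Finset.sum_add_distrib]
    have h := congrFun hmass s'
    simp only [mass] at h ⊢
    rw [h]
  · refine Finset.sum_eq_zero fun s hs => hzero s fun C hC hsC => ?_
    simp only [Set.Finite.mem_toFinset, Set.mem_compl_iff] at hs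
    exact hs ⟨C, hC, hsC⟩
  · exact fun s a ha => ⟨hp0 s a ha,
      (Finset.single_le_sum (hp0 s) ha).trans (hp.mass_le_one hπ s)⟩
  · exact fun s a _ => mul_nonneg (hy0 s) ((hπ s).1 a)
  · intro C hC s hs
    have hC' := isTSCC_iff.1 ((hiff C).2 hC)
    -- Other components are closed and disjoint from `C`, so `C` is entered only from transient
    -- states and carries some mass, which then spreads over all of `C`.
    obtain ⟨t, ht, hpos⟩ := hF.exists_pos (hclosed C hC) hC'.2.2 fun u hu u' hu' he D hD huD =>
      hu (IsTSCC.eq_of_mem hC hD hu' (hclosed D hD u huD u' he) ▸ huD)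
    exact hπ.isKernel.pos_of_reach (hp.mass_nonneg hπ) hst hpos (hC'.1 t ht s hs)

end MDP

/-! ### Construction of a feasible point -/

namespace LMDP

open scoped Classical

variable {S A : Type*} [Fintype S] {M : LMDP S A} {root : Set S → S} {π p : S → A → ℝ}

/-- The steady-state distribution of a class-preserving policy extends to a feasible point. -/
theorem exists_LP2Feasible (hM : ∀ C, M.TSCC C → C.Nontrivial)
    (hroot : ∀ C, M.TSCC C → root C ∈ C) (hπ : π ∈ M.classPreserving)
    (hp : M.IsSteadyState π p)
    (hspec : ∀ i, M.lo i ≤ ∑ s ∈ M.label i, ∑ a ∈ M.act s, p s a ∧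
      ∑ s ∈ M.label i, ∑ a ∈ M.act s, p s a ≤ M.hi i) :
    ∃ y f frev, M.LP2Feasible root p y f frev := by
  obtain ⟨⟨y, hQ0⟩, hpos⟩ := hp.exists_Q0 hπ
  obtain ⟨hπ, -, hiff⟩ := hπ
  have hst := hp.push_mass_eq hπ
  have hnn := hp.mass_nonneg hπ
  obtain ⟨c, hc⟩ : ∃ c : S → S → ℝ, ∀ s s', c s s' = M.mass p s * M.inducedT π s s' :=
    ⟨_, fun _ _ => rfl⟩
  have hcap : ∀ s s', ∑ a ∈ M.act s, M.T s a s' * p s a = c s s' := fun s s' => by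
    rw [hc, MDP.mass_mul_inducedT (hp.eq_mass_mul hπ)]
  have hc0 : ∀ s s', 0 ≤ c s s' := fun s s' => by
    rw [hc]; exact mul_nonneg (hnn s) (hπ.isKernel.nonneg s s')
  have hrow : ∀ s, ∑ s', c s s' ≤ 1 := fun s => by
    simp only [hc, ← Finset.mul_sum, hπ.isKernel.sum_eq, mul_one, hp.mass_le_one hπ]
  -- Stationarity bounds the column sums like the row sums, so the weight construction also applies
  -- to the reversed network.
  have hcol : ∀ s', ∑ s, c s s' ≤ 1 := fun s' => by
    have : push (M.inducedT π) (M.mass p) s' = M.mass p s' := congrFun hst s'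
    simp only [hc]
    exact this.trans_le (hp.mass_le_one hπ s')
  have hc1 : ∀ s s', c s s' ≤ 1 := fun s s' =>
    (Finset.single_le_sum (f := c s) (fun u _ => hc0 s u) (Finset.mem_univ s')).trans (hrow s)
  have hrel : ∀ s s', s ≠ s' → 0 < c s s' → M.TRel s s' := fun s s' hne h => by
    rw [hc] at h
    have hT : 0 < M.inducedT π s s' := (hπ.isKernel.nonneg s s').lt_of_ne fun h0 => by
      simp [← h0] at h
    exact ⟨hne, hπ.edge hT⟩
  have hconn : ∀ C, M.TSCC C → ∀ s ∈ C, ∀ s' ∈ C,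
      Relation.ReflTransGen (fun s s' => 0 < c s s') s s' := by
    intro C hC s hs s' hs'
    have hr := (isTSCC_iff.1 ((hiff C).2 hC)).1 s hs s' hs'
    clear hs'
    induction hr with
    | refl => exact .refl
    | @tail u v hsu he ih =>
      refine ih.tail ?_
      rw [hc]
      exact mul_pos (hπ.isKernel.pos_of_reach hnn hst (hpos C hC s hs) hsu) he
  have hconn' : ∀ C, M.TSCC C → ∀ s ∈ C, ∀ s' ∈ C,
      Relation.ReflTransGen (fun s s' => 0 < c s' s) s s' := fun C hC s hs s' hs' =>
    Relation.reflTransGen_swap.1 (hconn C hC s' hs' s hs)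
  -- All roots act as sources at once, so one weight per direction serves every component; being `1`
  -- at the roots, it saturates their outgoing capacities as required.
  obtain ⟨g, hg, hgZ, hflow⟩ := exists_flow_weight hc0 hrow hrel {s | ∃ C, M.TSCC C ∧ s = root C}
  obtain ⟨g', hg', hgZ', hflow'⟩ := exists_flow_weight (c := fun s s' => c s' s)
    (fun s s' => hc0 s' s) hcol (q := fun s s' => M.TRel s' s)
    (fun s s' hne => hrel s' s hne.symm) {s | ∃ C, M.TSCC C ∧ s = root C}
  have hZ : ∀ C, M.TSCC C → ∀ s ∈ C, s ≠ root C → s ∉ {s | ∃ C, M.TSCC C ∧ s = root C} := by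
    rintro C hC s hs hne ⟨D, hD, rfl⟩
    exact hne (IsTSCC.eq_of_mem hD hC (hroot D hD) hs ▸ rfl)
  refine ⟨y, fun s s' => c s s' * g s, fun s s' => c s' s * g' s, hQ0, hspec, ?_, ?_, ?_, ?_, ?_,
    ?_, ?_, ?_, ?_, ?_⟩
  · intro C hC s' _
    rw [hcap, hgZ _ ⟨C, hC, rfl⟩, mul_one]
  · intro C hC s' _
    rw [hcap, hgZ' _ ⟨C, hC, rfl⟩, mul_one]
  · intro C _ s s' _
    rw [hcap]
    exact mul_le_of_le_one_right (hc0 s s') (hg s).2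
  · intro C _ s s' _
    rw [hcap]
    exact mul_le_of_le_one_right (hc0 s' s) (hg' s).2
  · intro C hC s hs hne
    exact hflow s (hZ C hC s hs hne)
      ⟨root C, ⟨C, hC, rfl⟩, hconn C hC _ (hroot C hC) s hs⟩
  · intro C hC s hs hne
    exact hflow' s (hZ C hC s hs hne)
      ⟨root C, ⟨C, hC, rfl⟩, hconn' C hC _ (hroot C hC) s hs⟩
  · intro C hC s hs
    obtain ⟨t, ht, hne⟩ := (hM C hC).exists_ne s
    obtain ⟨u, hus, hu⟩ := exists_ne_edge (hconn C hC t ht s hs) hne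
    exact Finset.sum_pos' (fun s' _ => mul_nonneg (hc0 s' s) (hg s').1.le)
      ⟨u, by simpa using hrel u s hus hu, mul_pos hu (hg u).1⟩
  · intro C hC s hs
    obtain ⟨t, ht, hne⟩ := (hM C hC).exists_ne s
    obtain ⟨u, hus, hu⟩ := exists_ne_edge (hconn' C hC t ht s hs) hne
    exact Finset.sum_pos' (fun s' _ => mul_nonneg (hc0 s s') (hg' s').1.le)
      ⟨u, by simpa using hrel s u hus.symm hu, mul_pos hu (hg' u).1⟩
  · exact fun s s' _ => ⟨mul_nonneg (hc0 s s') (hg s).1.le,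
      mul_le_one₀ (hc1 s s') (hg s).1.le (hg s).2⟩
  · exact fun s s' _ => ⟨mul_nonneg (hc0 s' s) (hg' s).1.le,
      mul_le_one₀ (hc1 s' s) (hg' s).1.le (hg' s).2⟩

end LMDP

end SteadyState

/-! ### Correctness and optimality of the program -/

theorem mainTheorem2 {S A : Type*} [Fintype S] (M : SteadyState.LMDP S A)
    (hM : ∀ C, M.TSCC C → C.Nontrivial)
    (root : Set S → S) (hroot : ∀ C, M.TSCC C → root C ∈ C) :
    ((∃ x y f frev, M.LP2Feasible root x y f frev) ↔
      ∃ π ∈ M.classPreserving, M.MeetsSpecs π) ∧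
    ∀ x y f frev, M.LP2Optimal root x y f frev →
      ∀ π₀, M.IsStationaryPolicy π₀ →
        M.derivedPolicy x y π₀ ∈ M.classPreserving ∧
        M.MeetsSpecs (M.derivedPolicy x y π₀) ∧
        ∀ π ∈ M.classPreserving, M.MeetsSpecs π →
          M.avgReward π ≤ M.avgReward (M.derivedPolicy x y π₀) := by
  have key : ∀ x y f frev, M.LP2Feasible root x y f frev → ∀ π₀, M.IsStationaryPolicy π₀ →
      M.derivedPolicy x y π₀ ∈ M.classPreserving ∧ M.IsSteadyState (M.derivedPolicy x y π₀) x :=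
    fun x y f frev h π₀ h₀ => h.q0.derivedPolicy_spec h₀ (fun _ hC => h.mass_pos hC)
      fun C hC => ⟨root C, h.reach_root hC⟩
  refine ⟨⟨?_, ?_⟩, ?_⟩
  · rintro ⟨x, y, f, frev, h⟩
    obtain ⟨π₀, h₀⟩ := M.exists_isStationaryPolicy
    obtain ⟨h1, h2⟩ := key x y f frev h π₀ h₀
    exact ⟨_, h1, x, h2, h.specs⟩
  · rintro ⟨π, hπ, p, hp, hspec⟩
    exact ⟨p, SteadyState.LMDP.exists_LP2Feasible hM hroot hπ hp hspec⟩
  · rintro x y f frev ⟨h, hopt⟩ π₀ h₀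
    obtain ⟨h1, h2⟩ := key x y f frev h π₀ h₀
    refine ⟨h1, ⟨x, h2, h.specs⟩, ?_⟩
    rintro π hπ ⟨p, hp, hspec⟩
    obtain ⟨y', f', frev', h'⟩ :=
      SteadyState.LMDP.exists_LP2Feasible hM hroot hπ hp hspec
    rw [SteadyState.MDP.avgReward_eq hp, SteadyState.MDP.avgReward_eq h2]
    -- Both rewards are now objective values, and the competitor's steady state `p` is part of a
    -- feasible point.
    exact hopt p y' f' frev' h'
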